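/- Let $a>0$ and $b>0$ be real numbers with $b\neq 4a$, and let $T\subset\mathbb{P}^3$ be the torus with equation \[ (x^2+y^2+z^2+aw^2)^2-b(x^2+y^2)w^2=0 . \] Let $C_A\subset\mathbb{P}^3$ be the Euclidean absolute, i.e. the conic $w=x^2+y^2+z^2=0$. For a point $o\in\mathbb{P}^3(\mathbb{R})$, let $\pi:\mathbb{P}^3\setminus\{o\}\to\mathbb{P}^2$ be a central projection with centre $o$, i.e. the map given by a real $3\times 4$ matrix of rank $3$ with kernel $o$. The picture $T'\subset\mathbb{P}^2(\mathbb{C})$ of $T$ is the Zariski closure of the set of critical values of the restriction of $\pi$ to the smooth part of (the complex points of) $T$, and the elliptic absolute is $C_E=\pi(C_A)$. For a generic centre $o$ (that is, for every real point $o$ outside the zero set of some nonzero real form in four variables, which depends only on $a$ and $b$) and every such $\pi$, the picture $T'$ is a plane curve of degree eight (the zero set of a squarefree form of degree eight), and there are two distinct (complex) nodes of $T'$, that is, ordinary double points of $T'$, that lie on $C_E$. -/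

import Mathlib

open scoped LinearAlgebra.Projectivization Matrix

namespace TorusPicture

noncomputable section

/-- Complex projective `n`-space, the set of lines through `0` in `ℂ^(n+1)`. -/
abbrev ProjSpace (n : ℕ) : Type := ℙ ℂ (Fin (n + 1) → ℂ)

/-- The points of projective space at which a form `F` vanishes. -/
def zeroSet {n : ℕ} (F : MvPolynomial (Fin (n + 1)) ℂ) : Set (ProjSpace n) :=
  {p | MvPolynomial.eval p.rep F = 0}

/-- For a form, vanishing does not depend on the chosen homogeneous coordinates. -/
theorem mk_mem_zeroSet_iff {n d : ℕ} {F : MvPolynomial (Fin (n + 1)) ℂ}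
    (hF : F.IsHomogeneous d) (v : Fin (n + 1) → ℂ) (hv : v ≠ 0) :
    Projectivization.mk ℂ v hv ∈ zeroSet F ↔ MvPolynomial.eval v F = 0 := by
  obtain ⟨c, hc⟩ := Projectivization.exists_smul_eq_mk_rep ℂ v hv
  have h : MvPolynomial.eval (Projectivization.mk ℂ v hv).rep F
      = (c : ℂ) ^ d * MvPolynomial.eval v F := by
    rw [← hc, MvPolynomial.eval_eq, MvPolynomial.eval_eq, Finset.mul_sum]
    refine Finset.sum_congr rfl fun m hm => ?_
    have hd : ∑ i ∈ m.support, m i = d := by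
      have := hF (MvPolynomial.mem_support_iff.mp hm)
      rw [Finsupp.weight_apply] at this
      simpa [Finsupp.sum] using this
    rw [← hd, ← Finset.prod_pow_eq_pow_sum]
    simp only [Pi.smul_apply, Units.smul_def, smul_eq_mul, mul_pow, Finset.prod_mul_distrib]
    ring
  simp [zeroSet, h]

/-- The Zariski closure: all points at which every form vanishing on `A` vanishes. -/
def zariskiClosure {n : ℕ} (A : Set (ProjSpace n)) : Set (ProjSpace n) :=
  {p | ∀ (d : ℕ) (F : MvPolynomial (Fin (n + 1)) ℂ),
    F.IsHomogeneous d → A ⊆ zeroSet F → p ∈ zeroSet F}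

/-- The quartic form `(x² + y² + z² + a w²)² - b (x² + y²) w²` of a torus, in the coordinates
`x = X 0`, `y = X 1`, `z = X 2`, `w = X 3`. -/
def torusForm (a b : ℝ) : MvPolynomial (Fin 4) ℂ :=
  (MvPolynomial.X 0 ^ 2 + MvPolynomial.X 1 ^ 2 + MvPolynomial.X 2 ^ 2
      + MvPolynomial.C (a : ℂ) * MvPolynomial.X 3 ^ 2) ^ 2
    - MvPolynomial.C (b : ℂ) * (MvPolynomial.X 0 ^ 2 + MvPolynomial.X 1 ^ 2)
      * MvPolynomial.X 3 ^ 2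

/-- The Euclidean absolute `w = 0`, `x² + y² + z² = 0`. -/
def euclideanAbsolute : Set (ProjSpace 3) :=
  {p | p.rep 3 = 0 ∧ p.rep 0 ^ 2 + p.rep 1 ^ 2 + p.rep 2 ^ 2 = 0}

/-- The linear map `ℂ⁴ → ℂ³` of a real `3 × 4` matrix. -/
def projLin (P : Matrix (Fin 3) (Fin 4) ℝ) : (Fin 4 → ℂ) →ₗ[ℂ] (Fin 3 → ℂ) :=
  Matrix.toLin' (P.map (algebraMap ℝ ℂ))

/-- The image of a set of points under the central projection with matrix `P`, which is defined
away from the centre, i.e. away from the kernel of `P`. -/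
def projImage (P : Matrix (Fin 3) (Fin 4) ℝ) (A : Set (ProjSpace 3)) : Set (ProjSpace 2) :=
  {y | ∃ x ∈ A, ∃ h : projLin P x.rep ≠ 0, Projectivization.mk ℂ (projLin P x.rep) h = y}

/-- The elliptic absolute: the picture of the Euclidean absolute. -/
def ellipticAbsolute (P : Matrix (Fin 3) (Fin 4) ℝ) : Set (ProjSpace 2) :=
  projImage P euclideanAbsolute

/-- The smooth part of the surface `F = 0`, for a squarefree form `F`. -/
def smoothPart (F : MvPolynomial (Fin 4) ℂ) : Set (ProjSpace 3) :=
  {x | x ∈ zeroSet F ∧ ∃ i, MvPolynomial.eval x.rep (MvPolynomial.pderiv i F) ≠ 0}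

/-- The tangent space at `v` of the affine cone `F = 0` in `ℂ⁴`. At a smooth point `x = [v]` of
the projective surface, the tangent space of the surface is its quotient by the line `ℂ v`. -/
def coneTangent (F : MvPolynomial (Fin 4) ℂ) (v : Fin 4 → ℂ) : Submodule ℂ (Fin 4 → ℂ) :=
  LinearMap.ker (∑ i, MvPolynomial.eval v (MvPolynomial.pderiv i F) •
    (LinearMap.proj i : (Fin 4 → ℂ) →ₗ[ℂ] ℂ))

/-- The critical points of the central projection restricted to the smooth part of `F = 0`:
the differential, from `coneTangent F v / ℂ v` to the tangent space `ℂ³ / ℂ (P v)` of the plane,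
is not surjective. As `v` lies in `coneTangent F v` by Euler's formula, this says that `P` does
not map `coneTangent F v` onto `ℂ³`. -/
def criticalPoints (P : Matrix (Fin 3) (Fin 4) ℝ) (F : MvPolynomial (Fin 4) ℂ) :
    Set (ProjSpace 3) :=
  {x | x ∈ smoothPart F ∧ projLin P x.rep ≠ 0 ∧
    (coneTangent F x.rep).map (projLin P) ≠ ⊤}

/-- The picture of the surface `F = 0`: the Zariski closure of the critical value set of the
central projection restricted to the smooth part of the surface. -/
def picture (P : Matrix (Fin 3) (Fin 4) ℝ) (F : MvPolynomial (Fin 4) ℂ) : Set (ProjSpace 2) :=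
  zariskiClosure (projImage P (criticalPoints P F))

/-- `G` is a reduced defining form, of degree `d`, of the plane curve `S`; that is, `S` is a plane
curve of degree `d`, and `G` generates its ideal. -/
def IsDefiningForm (d : ℕ) (S : Set (ProjSpace 2)) (G : MvPolynomial (Fin 3) ℂ) : Prop :=
  G.IsHomogeneous d ∧ Squarefree G ∧ S = zeroSet G

/-- The matrix of second partial derivatives of a ternary form at `v`. -/
def hessian (G : MvPolynomial (Fin 3) ℂ) (v : Fin 3 → ℂ) : Matrix (Fin 3) (Fin 3) ℂ :=
  Matrix.of fun i j => MvPolynomial.eval v (MvPolynomial.pderiv i (MvPolynomial.pderiv j G))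

/-- `p` is a node (ordinary double point) of the plane curve with reduced form `G`: it is a
singular point at which the curve has two distinct tangent lines. The second order term of `G` at
`p` is a quadratic form on the two-dimensional tangent space `ℂ³ / ℂ v` of the plane at `p = [v]`
(the Hessian matrix kills `v` at a singular point); it is a product of two independent linear
forms exactly if it has rank two. -/
def IsNode (G : MvPolynomial (Fin 3) ℂ) (p : ProjSpace 2) : Prop :=
  p ∈ zeroSet G ∧ (∀ i, MvPolynomial.eval p.rep (MvPolynomial.pderiv i G) = 0) ∧
    (hessian G p.rep).rank = 2

end

end TorusPicture

/-! A smooth point of the torus is critical exactly when its tangent plane contains the centre, so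
the picture records the lines through the centre that touch the torus. Let the centre be `o = (x₀,
y₀, g, 1)` with `R = x₀² + y₀² ≠ 0`, and let `d` be a direction with radial, tangential and vertical
coordinates `α`, `β`, `ζ`. On the line `o + s d` the torus cuts out the quartic `Q(s)² - b r(s)`,
where `Q = x² + y² + z² + a` and `r = x² + y²` are quadratic in `s`. For every `l` it equals `(Q +
l/2)² - q_l` with `q_l = l Q + b r + l²/4`. The discriminant of `q_l` is a cubic in `l`, a resolvent
of the quartic, and tangency makes it have a double root. With `l = b (μ - 1)` its coefficients `c₃,
…, c₀` are quadratic forms in the direction, and its discriminant `pictureForm` has degree eight.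

The shift is chosen because `q_l` depends on `z` alone at `l = -b`, so that `c₀ = (4a - b) ζ²`. At
the circular directions `ζ = α² + β² = 0`, which lie on the absolute, `c₃` and `c₁` vanish too, and
to second order the discriminant is `c₂² (c₁² - 4 c₂ c₀)`. As `b ≠ 4a` and the differentials of `c₁`
and `ζ` are independent there, these points are nodes (`isNode_form`).

The curve is the whole closure: the form is squarefree (`squarefree_pictureForm`) and shares no
component with the absolute, where tangency may escape to infinity, or with `β = 0`, the lines
meeting the axis, which carries the finite singular points. The Nullstellensatz then shows that the
form divides every form vanishing on the critical values (`pictureForm_dvd`, `picture_eq`). -/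

namespace TorusPicture

/-! ### Factors of forms, coprimality and squarefreeness -/

open MvPolynomial in
/-- The evaluation of a form at a multiple of a vector. -/
theorem eval_smul_of_isHomogeneous {σ : Type*} {d : ℕ} {F : MvPolynomial σ ℂ}
    (hF : F.IsHomogeneous d) (c : ℂ) (v : σ → ℂ) :
    eval (c • v) F = c ^ d * eval v F := by
  rw [eval_eq, eval_eq, Finset.mul_sum]
  refine Finset.sum_congr rfl fun m hm => ?_
  have hd : ∑ i ∈ m.support, m i = d := by
    have := hF (mem_support_iff.mp hm)
    rw [Finsupp.weight_apply] at this
    simpa [Finsupp.sum] using this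
  rw [← hd, ← Finset.prod_pow_eq_pow_sum]
  simp only [Pi.smul_apply, smul_eq_mul, mul_pow, Finset.prod_mul_distrib]
  ring

open MvPolynomial in
/-- The homogeneous components of a polynomial are the coefficients of `F (t X)` in `t`. -/
theorem coeff_aeval_C_X_mul_X {σ : Type*} (F : MvPolynomial σ ℂ) (k : ℕ) :
    (aeval (fun i => (Polynomial.C (X i) * Polynomial.X : Polynomial (MvPolynomial σ ℂ))) F).coeff k
      = homogeneousComponent k F := by
  induction F using MvPolynomial.induction_on' with
  | monomial m r =>
    have h : aeval (fun i => (Polynomial.C (X i) * Polynomial.X : Polynomial (MvPolynomial σ ℂ)))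
        (monomial m r) = Polynomial.monomial m.degree (monomial m r) := by
      rw [aeval_monomial, ← Polynomial.C_mul_X_pow_eq_monomial, monomial_eq,
        Polynomial.algebraMap_apply, algebraMap_eq, Finsupp.degree_apply,
        ← Finset.prod_pow_eq_pow_sum]
      simp only [Finsupp.prod, mul_pow, Finset.prod_mul_distrib, map_mul, map_prod, map_pow,
        mul_assoc]
    rw [h, Polynomial.coeff_monomial, homogeneousComponent_of_mem (isHomogeneous_monomial r rfl)]
    simp only [eq_comm]
  | add F K h1 h2 => rw [map_add, Polynomial.coeff_add, h1, h2, map_add]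

open MvPolynomial in
-- `F (t X)` is a monomial in `t`. Highest and lowest degree in `t` are additive over products, so
-- they agree for each factor.
theorem isHomogeneous_of_dvd {σ : Type*} {d : ℕ} {F D : MvPolynomial σ ℂ}
    (hF : F.IsHomogeneous d) (hF0 : F ≠ 0) (h : D ∣ F) : ∃ k, D.IsHomogeneous k := by
  obtain ⟨K, rfl⟩ := h
  have hD : D ≠ 0 := left_ne_zero_of_mul hF0
  have hK : K ≠ 0 := right_ne_zero_of_mul hF0
  set φ : MvPolynomial σ ℂ →ₐ[ℂ] Polynomial (MvPolynomial σ ℂ) :=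
    aeval (fun i => (Polynomial.C (X i) * Polynomial.X : Polynomial (MvPolynomial σ ℂ))) with hφ
  have hcoeff : ∀ F k, (φ F).coeff k = homogeneousComponent k F := coeff_aeval_C_X_mul_X
  have hinj : ∀ F, F ≠ 0 → φ F ≠ 0 := by
    intro F hF h0
    apply hF
    rw [← sum_homogeneousComponent F]
    exact Finset.sum_eq_zero fun i _ => by rw [← hcoeff, h0, Polynomial.coeff_zero]
  have hmon : φ (D * K) = Polynomial.monomial d (D * K) := by
    ext1 k
    rw [hcoeff, homogeneousComponent_of_mem hF, Polynomial.coeff_monomial]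
    simp only [eq_comm]
  have h1 : (φ D).natDegree + (φ K).natDegree = d := by
    rw [← Polynomial.natDegree_mul (hinj _ hD) (hinj _ hK), ← map_mul, hmon,
      Polynomial.natDegree_monomial_eq _ hF0]
  have h2 : (φ D).natTrailingDegree + (φ K).natTrailingDegree = d := by
    rw [← Polynomial.natTrailingDegree_mul (hinj _ hD) (hinj _ hK), ← map_mul, hmon,
      Polynomial.natTrailingDegree_monomial hF0]
  have h3 := (φ D).natTrailingDegree_le_natDegree
  have h4 := (φ K).natTrailingDegree_le_natDegree
  refine ⟨(φ D).natDegree, ?_⟩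
  have : D = homogeneousComponent (φ D).natDegree D := by
    conv_lhs => rw [← sum_homogeneousComponent D]
    by_cases hmem : (φ D).natDegree ∈ Finset.range (D.totalDegree + 1)
    · refine Finset.sum_eq_single_of_mem _ hmem fun i _ hi => ?_
      rw [← hcoeff]
      rcases lt_or_gt_of_ne hi with hi | hi
      · exact Polynomial.coeff_eq_zero_of_lt_natTrailingDegree (by omega)
      · exact Polynomial.coeff_eq_zero_of_natDegree_lt hi
    · exfalso
      rw [Finset.mem_range, not_lt] at hmem
      have : (φ D).coeff (φ D).natDegree = 0 := by
        rw [hcoeff]; exact homogeneousComponent_eq_zero _ _ (by omega)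
      rw [Polynomial.coeff_natDegree, Polynomial.leadingCoeff_eq_zero] at this
      exact hinj _ hD this
  rw [this]
  convert homogeneousComponent_isHomogeneous _ _ using 2
  rw [← this]

open MvPolynomial in
/-- A form of positive degree has a nontrivial zero on every plane through the origin. -/
theorem exists_eval_eq_zero_of_isHomogeneous {σ : Type*} {d : ℕ} {F : MvPolynomial σ ℂ}
    (hF : F.IsHomogeneous d) (hd : d ≠ 0) (e f : σ → ℂ) :
    ∃ s t : ℂ, (s ≠ 0 ∨ t ≠ 0) ∧ eval (s • e + t • f) F = 0 := by
  by_contra! hcon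
  set p : Polynomial ℂ := aeval (fun i => Polynomial.C (e i) + Polynomial.C (f i) * Polynomial.X) F
    with hp
  have hpe : ∀ t, p.eval t = eval (e + t • f) F := by
    intro t
    rw [hp, ← Polynomial.coe_aeval_eq_eval, comp_aeval_apply, aeval_eq_eval]
    congr 2
    funext i
    rw [Polynomial.coe_aeval_eq_eval, Polynomial.eval_add, Polynomial.eval_mul, Polynomial.eval_C,
      Polynomial.eval_C, Polynomial.eval_X, Pi.add_apply, Pi.smul_apply, smul_eq_mul, mul_comm]
  have hroot : p.degree = 0 := by
    by_contra hdeg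
    obtain ⟨t, ht⟩ := IsAlgClosed.exists_root p hdeg
    refine hcon 1 t (Or.inl one_ne_zero) ?_
    rw [one_smul, ← hpe]
    exact ht
  rw [Polynomial.eq_C_of_degree_eq_zero hroot] at hpe
  simp only [Polynomial.eval_C] at hpe
  set c := p.coeff 0
  -- Without zeros on `e + t f`, `F` is a constant `c` there. Homogeneity gives `c s ^ d` on `s e +
  -- f` for `s ≠ 0`, hence also at `s = 0`, which makes `f` a zero.
  have hq : ∀ s : ℂ, s ≠ 0 → eval (s • e + f) F = s ^ d * c := by
    intro s hs
    rw [hpe s⁻¹, ← eval_smul_of_isHomogeneous hF, smul_add, smul_smul, mul_inv_cancel₀ hs, one_smul]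
  set q : Polynomial ℂ := aeval (fun i => Polynomial.C (f i) + Polynomial.C (e i) * Polynomial.X) F
    with hq'
  have hqe : ∀ t, q.eval t = eval (t • e + f) F := by
    intro t
    rw [hq', ← Polynomial.coe_aeval_eq_eval, comp_aeval_apply, aeval_eq_eval]
    congr 2
    funext i
    rw [Polynomial.coe_aeval_eq_eval, Polynomial.eval_add, Polynomial.eval_mul, Polynomial.eval_C,
      Polynomial.eval_C, Polynomial.eval_X, Pi.add_apply, Pi.smul_apply, smul_eq_mul, mul_comm,
      add_comm]
  have hqeq : q = Polynomial.C c * Polynomial.X ^ d := by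
    refine Polynomial.eq_of_infinite_eval_eq _ _ (Set.Infinite.mono (s := {0}ᶜ) ?_
      (Set.finite_singleton _).infinite_compl)
    intro s hs
    rw [Set.mem_ofPred_eq, hqe, hq s hs, Polynomial.eval_mul, Polynomial.eval_C,
      Polynomial.eval_pow, Polynomial.eval_X, mul_comm]
  refine hcon 0 1 (Or.inr one_ne_zero) ?_
  rw [one_smul, ← hqe, hqeq]
  simp [hd]

open MvPolynomial in
theorem isUnit_of_isHomogeneous_zero {σ : Type*} {F : MvPolynomial σ ℂ}
    (hF : F.IsHomogeneous 0) (h0 : F ≠ 0) : IsUnit F := by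
  rw [← totalDegree_zero_iff_isHomogeneous, totalDegree_eq_zero_iff_eq_C] at hF
  rw [hF] at h0 ⊢
  exact (IsUnit.mk0 _ (by rintro h; simp [h] at h0)).map C

open MvPolynomial in
/-- Two forms without common zeros on some plane through the origin have no common factor. -/
theorem isRelPrime_of_no_common_zero {σ : Type*} {d : ℕ} {F K : MvPolynomial σ ℂ}
    (hF : F.IsHomogeneous d) (hF0 : F ≠ 0) (e f : σ → ℂ)
    (h : ∀ s t : ℂ, (s ≠ 0 ∨ t ≠ 0) → eval (s • e + t • f) F = 0 → eval (s • e + t • f) K ≠ 0) :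
    IsRelPrime F K := by
  intro D hDF hDK
  obtain ⟨k, hk⟩ := isHomogeneous_of_dvd hF hF0 hDF
  rcases eq_or_ne k 0 with rfl | hk0
  · exact isUnit_of_isHomogeneous_zero hk (ne_zero_of_dvd_ne_zero hF0 hDF)
  · exfalso
    obtain ⟨s, t, hst, h0⟩ := exists_eval_eq_zero_of_isHomogeneous hk hk0 e f
    obtain ⟨A, rfl⟩ := hDF
    obtain ⟨B, rfl⟩ := hDK
    exact h s t hst (by rw [map_mul, h0, zero_mul]) (by rw [map_mul, h0, zero_mul])

open MvPolynomial in
/-- A ternary form is squarefree if its singular points on some line have a Hessian matrix of rank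
at least two. -/
theorem squarefree_of_hessian {d : ℕ} {F : MvPolynomial (Fin 3) ℂ}
    (hF : F.IsHomogeneous d) (hF0 : F ≠ 0) (e f : Fin 3 → ℂ)
    (h : ∀ s t : ℂ, (s ≠ 0 ∨ t ≠ 0) → eval (s • e + t • f) F = 0 →
      (∀ i, eval (s • e + t • f) (pderiv i F) = 0) → 2 ≤ (hessian F (s • e + t • f)).rank) :
    Squarefree F := by
  intro D hD
  obtain ⟨k, hk⟩ := isHomogeneous_of_dvd hF hF0 ((dvd_mul_right D D).trans hD)
  rcases eq_or_ne k 0 with rfl | hk0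
  · exact isUnit_of_isHomogeneous_zero hk (ne_zero_of_dvd_ne_zero hF0 ((dvd_mul_right D D).trans hD))
  · exfalso
    obtain ⟨s, t, hst, h0⟩ := exists_eval_eq_zero_of_isHomogeneous hk hk0 e f
    obtain ⟨A, rfl⟩ := hD
    set v := s • e + t • f
    have h1 := h s t hst (by rw [map_mul, map_mul, h0, zero_mul, zero_mul])
      (fun i => by simp only [pderiv_mul, map_add, map_mul]; rw [h0]; ring)
    -- At a zero of `D` only the terms that differentiate both factors `D` survive, and they have
    -- rank at most one.
    have h2 : hessian (D * D * A) v
        = Matrix.vecMulVec (fun i => 2 * eval v A * eval v (pderiv i D))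
            (fun i => eval v (pderiv i D)) := by
      ext i j
      simp only [hessian, Matrix.of_apply, Matrix.vecMulVec_apply, pderiv_mul, map_add, map_mul, h0]
      ring
    rw [h2] at h1
    have := Matrix.rank_vecMulVec_le (fun i => 2 * eval v A * eval v (pderiv i D))
            (fun i => eval v (pderiv i D))
    omega

/-! ### Linear changes of coordinates in the plane -/

section ChangeOfCoordinates

open MvPolynomial

/-- The polynomial `F (M X)`. -/
noncomputable def linSubst (M : Matrix (Fin 3) (Fin 3) ℂ) :
    MvPolynomial (Fin 3) ℂ →ₐ[ℂ] MvPolynomial (Fin 3) ℂ :=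
  aeval fun i => ∑ j, C (M i j) * X j

theorem eval_linSubst (M : Matrix (Fin 3) (Fin 3) ℂ) (v : Fin 3 → ℂ)
    (F : MvPolynomial (Fin 3) ℂ) : eval v (linSubst M F) = eval (M *ᵥ v) F := by
  rw [linSubst, ← aeval_eq_eval, ← aeval_eq_eval]
  change aeval v (aeval (fun i => ∑ j, C (M i j) * X j) F) = _
  rw [comp_aeval_apply]
  congr 2
  funext i
  rw [map_sum, Matrix.mulVec, dotProduct]
  refine Finset.sum_congr rfl fun j _ => ?_
  rw [map_mul, aeval_X, aeval_C, Algebra.algebraMap_self, RingHom.id_apply]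

theorem isHomogeneous_linSubst (M : Matrix (Fin 3) (Fin 3) ℂ) {d : ℕ}
    {F : MvPolynomial (Fin 3) ℂ} (hF : F.IsHomogeneous d) : (linSubst M F).IsHomogeneous d := by
  have := hF.aeval (fun i => ∑ j, C (M i j) * X j) (n := 1)
    (fun i => IsHomogeneous.sum _ _ _ fun j _ => isHomogeneous_C_mul_X _ _)
  rwa [one_mul] at this

theorem linSubst_linSubst {M N : Matrix (Fin 3) (Fin 3) ℂ} (h : M * N = 1)
    (F : MvPolynomial (Fin 3) ℂ) : linSubst N (linSubst M F) = F := by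
  refine MvPolynomial.funext fun v => ?_
  rw [eval_linSubst, eval_linSubst, Matrix.mulVec_mulVec, h, Matrix.one_mulVec]

theorem pderiv_linSubst (M : Matrix (Fin 3) (Fin 3) ℂ) (i : Fin 3) (F : MvPolynomial (Fin 3) ℂ) :
    pderiv i (linSubst M F) = ∑ j, C (M j i) * linSubst M (pderiv j F) := by
  induction F using MvPolynomial.induction_on with
  | C a => simp [linSubst, algHom_C]
  | add p q hp hq => simp only [map_add, hp, hq, mul_add, Finset.sum_add_distrib]
  | mul_X p k hp =>
    have h1 : pderiv i (linSubst M (X k)) = C (M k i) := by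
      rw [linSubst, aeval_X, map_sum, Finset.sum_eq_single i]
      · rw [pderiv_C_mul, pderiv_X_self, mul_one]
      · intro j _ hj
        rw [pderiv_C_mul, pderiv_X_of_ne hj, mul_zero]
      · intro h
        exact absurd (Finset.mem_univ i) h
    have h2 : ∀ j, C (M j i) * linSubst M (pderiv j (p * X k))
        = C (M j i) * linSubst M (pderiv j p) * linSubst M (X k)
          + linSubst M p * (C (M j i) * linSubst M (pderiv j (X k))) := by
      intro j
      rw [pderiv_mul, map_add, map_mul, map_mul]
      ring
    have h3 : ∑ j, C (M j i) * linSubst M (pderiv j (X k)) = C (M k i) := by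
      rw [Finset.sum_eq_single k]
      · rw [pderiv_X_self, map_one, mul_one]
      · intro j _ hj
        rw [pderiv_X_of_ne hj.symm, map_zero, mul_zero]
      · intro h
        exact absurd (Finset.mem_univ k) h
    rw [Finset.sum_congr rfl fun j _ => h2 j, Finset.sum_add_distrib, ← Finset.sum_mul,
      ← Finset.mul_sum, h3, ← hp, map_mul, pderiv_mul, h1]

theorem hessian_linSubst (M : Matrix (Fin 3) (Fin 3) ℂ) (F : MvPolynomial (Fin 3) ℂ)
    (v : Fin 3 → ℂ) : hessian (linSubst M F) v = Mᵀ * hessian F (M *ᵥ v) * M := by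
  ext i j
  simp only [hessian, Matrix.of_apply, pderiv_linSubst, map_sum, pderiv_mul, pderiv_C, zero_mul,
    zero_add, map_mul, eval_C, eval_linSubst, Matrix.mul_apply, Matrix.transpose_apply,
    Finset.mul_sum, Finset.sum_mul]
  refine Finset.sum_congr rfl fun k _ => Finset.sum_congr rfl fun l _ => ?_
  ring

theorem squarefree_linSubst {M N : Matrix (Fin 3) (Fin 3) ℂ} (h : M * N = 1)
    {F : MvPolynomial (Fin 3) ℂ} (hF : Squarefree F) : Squarefree (linSubst M F) := by
  intro D hD
  have h1 := map_dvd (linSubst N) hD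
  rw [linSubst_linSubst h, map_mul] at h1
  have h2 := (hF _ h1).map (linSubst M)
  rwa [linSubst_linSubst (mul_eq_one_comm.mp h)] at h2

end ChangeOfCoordinates

/-! ### Discriminant and double roots of a cubic -/

section Cubic

/-- The discriminant of the binary cubic form with coefficients `c₃`, `c₂`, `c₁`, `c₀`. -/
def cubicDisc {A : Type*} [CommRing A] (c₃ c₂ c₁ c₀ : A) : A :=
  c₂ ^ 2 * c₁ ^ 2 - 4 * c₃ * c₁ ^ 3 - 4 * c₂ ^ 3 * c₀ - 27 * c₃ ^ 2 * c₀ ^ 2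
    + 18 * c₃ * c₂ * c₁ * c₀

theorem cubicDisc_eq_zero_of_double_root {A : Type*} [CommRing A] {c₃ c₂ c₁ c₀ μ : A}
    (h0 : c₃ * μ ^ 3 + c₂ * μ ^ 2 + c₁ * μ + c₀ = 0)
    (h1 : 3 * c₃ * μ ^ 2 + 2 * c₂ * μ + c₁ = 0) : cubicDisc c₃ c₂ c₁ c₀ = 0 := by
  have e1 : c₁ = -(3 * c₃ * μ ^ 2 + 2 * c₂ * μ) := by linear_combination h1
  have e0 : c₀ = 2 * c₃ * μ ^ 3 + c₂ * μ ^ 2 := by linear_combination h0 - μ * h1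
  rw [cubicDisc, e0, e1]
  ring

theorem exists_double_root_of_cubicDisc_eq_zero {c₃ c₂ c₁ c₀ : ℂ} (hc : c₃ ≠ 0)
    (h : cubicDisc c₃ c₂ c₁ c₀ = 0) :
    ∃ μ, c₃ * μ ^ 3 + c₂ * μ ^ 2 + c₁ * μ + c₀ = 0 ∧ 3 * c₃ * μ ^ 2 + 2 * c₂ * μ + c₁ = 0 := by
  obtain ⟨r, hr⟩ := IsAlgClosed.exists_root (Cubic.mk c₃ c₂ c₁ c₀).toPoly
    (by rw [Cubic.degree_of_a_ne_zero hc]; decide)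
  have hr' : c₃ * r ^ 3 + c₂ * r ^ 2 + c₁ * r + c₀ = 0 := by
    simpa [Cubic.toPoly, Polynomial.IsRoot] using hr
  have e0 : c₀ = -(c₃ * r ^ 3 + c₂ * r ^ 2 + c₁ * r) := by linear_combination hr'
  -- The discriminant is the squared derivative at the root `r` times the discriminant of the
  -- quadratic cofactor, so either `r` or the root of the cofactor is double.
  have hf : (3 * c₃ * r ^ 2 + 2 * c₂ * r + c₁) ^ 2
      * ((c₂ + c₃ * r) ^ 2 - 4 * c₃ * (c₁ + c₂ * r + c₃ * r ^ 2)) = 0 := by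
    rw [← h, cubicDisc, e0]
    ring
  rcases mul_eq_zero.mp hf with h1 | h1
  · exact ⟨r, hr', pow_eq_zero_iff two_ne_zero |>.mp h1⟩
  · set m := -(c₂ + c₃ * r) / (2 * c₃) with hm
    have hm' : 2 * c₃ * m = -(c₂ + c₃ * r) := by rw [hm]; field_simp
    have hq : c₃ * m ^ 2 + (c₂ + c₃ * r) * m + (c₁ + c₂ * r + c₃ * r ^ 2) = 0 := by
      have : 4 * c₃ * (c₃ * m ^ 2 + (c₂ + c₃ * r) * m + (c₁ + c₂ * r + c₃ * r ^ 2)) = 0 := by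
        linear_combination (2 * c₃ * m + (c₂ + c₃ * r)) * hm' - h1
      exact (mul_eq_zero.mp this).resolve_left (mul_ne_zero (by norm_num) hc)
    refine ⟨m, ?_, ?_⟩
    · linear_combination (m - r) * hq + hr'
    · linear_combination hq + (m - r) * hm'

end Cubic

/-! ### The quadratic forms that occur as coefficients -/

section QuadraticForm

open MvPolynomial

/-- The quadratic form `p (X₀² + X₁²) + q X₁² + r X₂² + s X₀ X₂`. -/
noncomputable def quadForm (p q r s : ℂ) : MvPolynomial (Fin 3) ℂ :=
  C p * (X 0 ^ 2 + X 1 ^ 2) + C q * X 1 ^ 2 + C r * X 2 ^ 2 + C s * (X 0 * X 2)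

variable (p q r s : ℂ) (v : Fin 3 → ℂ)

theorem isHomogeneous_quadForm : (quadForm p q r s).IsHomogeneous 2 := by
  unfold quadForm
  have hX : ∀ i : Fin 3, (X i ^ 2 : MvPolynomial (Fin 3) ℂ).IsHomogeneous 2 :=
    fun i => isHomogeneous_X_pow i 2
  exact (((((hX 0).add (hX 1)).C_mul p).add ((hX 1).C_mul q)).add ((hX 2).C_mul r)).add
    (((isHomogeneous_X ℂ 0).mul (isHomogeneous_X ℂ 2)).C_mul s)

theorem eval_quadForm : eval v (quadForm p q r s)
    = p * (v 0 ^ 2 + v 1 ^ 2) + q * v 1 ^ 2 + r * v 2 ^ 2 + s * (v 0 * v 2) := by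
  simp [quadForm]

theorem pderiv_zero_quadForm :
    pderiv 0 (quadForm p q r s) = C (2 * p) * X 0 + C s * X 2 := by
  have h1 : pderiv 0 (X 1 : MvPolynomial (Fin 3) ℂ) = 0 := pderiv_X_of_ne (by decide)
  have h2 : pderiv 0 (X 2 : MvPolynomial (Fin 3) ℂ) = 0 := pderiv_X_of_ne (by decide)
  simp only [quadForm, map_add, pderiv_C, pderiv_pow, pderiv_mul, pderiv_X_self, h1, h2,
    map_mul, map_ofNat]
  push_cast
  ring

theorem pderiv_one_quadForm :
    pderiv 1 (quadForm p q r s) = C (2 * (p + q)) * X 1 := by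
  have h1 : pderiv 1 (X 0 : MvPolynomial (Fin 3) ℂ) = 0 := pderiv_X_of_ne (by decide)
  have h2 : pderiv 1 (X 2 : MvPolynomial (Fin 3) ℂ) = 0 := pderiv_X_of_ne (by decide)
  simp only [quadForm, map_add, pderiv_C, pderiv_pow, pderiv_mul, pderiv_X_self, h1, h2,
    map_mul, map_ofNat]
  push_cast
  ring

theorem pderiv_two_quadForm :
    pderiv 2 (quadForm p q r s) = C (2 * r) * X 2 + C s * X 0 := by
  have h1 : pderiv 2 (X 0 : MvPolynomial (Fin 3) ℂ) = 0 := pderiv_X_of_ne (by decide)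
  have h2 : pderiv 2 (X 1 : MvPolynomial (Fin 3) ℂ) = 0 := pderiv_X_of_ne (by decide)
  simp only [quadForm, map_add, pderiv_C, pderiv_pow, pderiv_mul, pderiv_X_self, h1, h2,
    map_mul, map_ofNat]
  push_cast
  ring

end QuadraticForm

/-! ### Derivatives of the discriminant of a cubic with form coefficients -/

section Derivatives

open MvPolynomial

variable {c₃ c₂ c₁ c₀ : MvPolynomial (Fin 3) ℂ} {v : Fin 3 → ℂ}

theorem eval_cubicDisc : eval v (cubicDisc c₃ c₂ c₁ c₀)
    = cubicDisc (eval v c₃) (eval v c₂) (eval v c₁) (eval v c₀) := by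
  simp [cubicDisc]

theorem isHomogeneous_cubicDisc {d : ℕ} (h₃ : c₃.IsHomogeneous d) (h₂ : c₂.IsHomogeneous d)
    (h₁ : c₁.IsHomogeneous d) (h₀ : c₀.IsHomogeneous d) :
    (cubicDisc c₃ c₂ c₁ c₀).IsHomogeneous (4 * d) := by
  have e : cubicDisc c₃ c₂ c₁ c₀ = c₂ * c₂ * c₁ * c₁ - C 4 * (c₃ * c₁ * c₁ * c₁)
      - C 4 * (c₂ * c₂ * c₂ * c₀) - C 27 * (c₃ * c₃ * c₀ * c₀) + C 18 * (c₃ * c₂ * c₁ * c₀) := by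
    simp only [cubicDisc, map_ofNat]; ring
  have hm : ∀ {x y z w : MvPolynomial (Fin 3) ℂ}, x.IsHomogeneous d → y.IsHomogeneous d →
      z.IsHomogeneous d → w.IsHomogeneous d → (x * y * z * w).IsHomogeneous (4 * d) := by
    intro x y z w hx hy hz hw
    rw [show 4 * d = d + d + d + d by ring]
    exact ((hx.mul hy).mul hz).mul hw
  rw [e]
  exact ((((hm h₂ h₂ h₁ h₁).sub ((hm h₃ h₁ h₁ h₁).C_mul 4)).sub ((hm h₂ h₂ h₂ h₀).C_mul 4)).sub
    ((hm h₃ h₃ h₀ h₀).C_mul 27)).add ((hm h₃ h₂ h₁ h₀).C_mul 18)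

theorem pderiv_cubicDisc (i : Fin 3) : pderiv i (cubicDisc c₃ c₂ c₁ c₀)
    = (-4 * c₁ ^ 3 - 54 * c₃ * c₀ ^ 2 + 18 * c₂ * c₁ * c₀) * pderiv i c₃
      + (2 * c₂ * c₁ ^ 2 - 12 * c₂ ^ 2 * c₀ + 18 * c₃ * c₁ * c₀) * pderiv i c₂
      + (2 * c₂ ^ 2 * c₁ - 12 * c₃ * c₁ ^ 2 + 18 * c₃ * c₂ * c₀) * pderiv i c₁
      + (-4 * c₂ ^ 3 - 54 * c₃ ^ 2 * c₀ + 18 * c₃ * c₂ * c₁) * pderiv i c₀ := by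
  have hn : ∀ (n : ℕ) [n.AtLeastTwo],
      pderiv i (OfNat.ofNat n : MvPolynomial (Fin 3) ℂ) = 0 := by
    intro n _
    rw [← map_ofNat C, pderiv_C]
  simp only [cubicDisc, map_add, map_sub, pderiv_mul, pderiv_pow, hn]
  push_cast
  ring

/-- Since `c₀` vanishes to order two and `c₃`, `c₁` to order one, every term except `c₂² c₁²` and
`-4 c₂³ c₀` has order at least three. -/
theorem hessian_cubicDisc (h₃ : eval v c₃ = 0) (h₁ : eval v c₁ = 0) (h₀ : eval v c₀ = 0)
    (hd : ∀ i, eval v (pderiv i c₀) = 0) (i j : Fin 3) :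
    hessian (cubicDisc c₃ c₂ c₁ c₀) v i j
      = 2 * eval v c₂ ^ 2 * (eval v (pderiv i c₁) * eval v (pderiv j c₁))
        - 4 * eval v c₂ ^ 3 * eval v (pderiv i (pderiv j c₀)) := by
  have hn : ∀ (n : ℕ) [n.AtLeastTwo],
      pderiv i (OfNat.ofNat n : MvPolynomial (Fin 3) ℂ) = 0 := by
    intro n _
    rw [← map_ofNat C, pderiv_C]
  rw [hessian, Matrix.of_apply, pderiv_cubicDisc]
  simp only [map_add, map_sub, map_neg, pderiv_mul, pderiv_pow, hn, map_mul, map_pow, h₃, h₁, h₀, hd,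
    map_ofNat, map_natCast]
  push_cast
  ring

end Derivatives

/-! ### The resolvent cubic of a line -/

section DoubleTangency

/-- The coefficients of the cubic whose discriminant defines the picture. -/
theorem cubic_eq (a b R g α β ζ μ : ℂ) :
    4 * ((b * (μ - 1) * (R * (α ^ 2 + β ^ 2) + ζ ^ 2) + b * (R * (α ^ 2 + β ^ 2)))
        * (b * (μ - 1) * (R + g ^ 2 + a) + b * R + (b * (μ - 1)) ^ 2 / 4)
      - (b * (μ - 1) * (R * α + g * ζ) + b * (R * α)) ^ 2)
    = b ^ 2 * (b * (R * (α ^ 2 + β ^ 2) + ζ ^ 2) * μ ^ 3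
      + ((4 * (g ^ 2 + a) - 2 * b) * R * (α ^ 2 + β ^ 2) + 4 * R ^ 2 * β ^ 2
        + (4 * R + 4 * a - 3 * b) * ζ ^ 2 + -8 * R * g * (α * ζ)) * μ ^ 2
      + (R * (b - 4 * (g ^ 2 + a)) * (α ^ 2 + β ^ 2) + (3 * b - 4 * R - 8 * a) * ζ ^ 2
        + 8 * R * g * (α * ζ)) * μ
      + (4 * a - b) * ζ ^ 2) := by
  ring

end DoubleTangency

/-! ### The octic form of tangent directions -/

section PictureForm

open MvPolynomial

/-- A reduced defining form of the picture of the torus from a centre `(x₀, y₀, g, 1)` with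
`x₀² + y₀² = R`, in the coordinates `α`, `β`, `ζ` of the line through the centre
with direction `(α x₀ - β y₀, α y₀ + β x₀, ζ, 0)`. -/
noncomputable def pictureForm (a b R g : ℂ) : MvPolynomial (Fin 3) ℂ :=
  cubicDisc (quadForm (b * R) 0 b 0)
    (quadForm ((4 * (g ^ 2 + a) - 2 * b) * R) (4 * R ^ 2) (4 * R + 4 * a - 3 * b) (-8 * R * g))
    (quadForm (R * (b - 4 * (g ^ 2 + a))) 0 (3 * b - 4 * R - 8 * a) (8 * R * g))
    (quadForm 0 0 (4 * a - b) 0)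

variable {a b R g : ℂ}

theorem isHomogeneous_pictureForm (a b R g : ℂ) : (pictureForm a b R g).IsHomogeneous 8 :=
  isHomogeneous_cubicDisc (isHomogeneous_quadForm ..) (isHomogeneous_quadForm ..)
    (isHomogeneous_quadForm ..) (isHomogeneous_quadForm ..)

/-- This is `cubic_eq` differentiated in `μ`; the left side is the product rule applied to the
discriminant of `q_l`, with the factor `b` from `l = b (μ - 1)`. -/
theorem cubic_eq_derivative (a b R g α β ζ μ : ℂ) :
    4 * b * ((R * (α ^ 2 + β ^ 2) + ζ ^ 2)
        * (b * (μ - 1) * (R + g ^ 2 + a) + b * R + (b * (μ - 1)) ^ 2 / 4)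
      + (b * (μ - 1) * (R * (α ^ 2 + β ^ 2) + ζ ^ 2) + b * (R * (α ^ 2 + β ^ 2)))
        * (R + g ^ 2 + a + (b * (μ - 1)) / 2)
      - 2 * (R * α + g * ζ) * (b * (μ - 1) * (R * α + g * ζ) + b * (R * α)))
    = b ^ 2 * (3 * (b * (R * (α ^ 2 + β ^ 2) + ζ ^ 2)) * μ ^ 2
      + 2 * ((4 * (g ^ 2 + a) - 2 * b) * R * (α ^ 2 + β ^ 2) + 4 * R ^ 2 * β ^ 2
        + (4 * R + 4 * a - 3 * b) * ζ ^ 2 + -8 * R * g * (α * ζ)) * μ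
      + (R * (b - 4 * (g ^ 2 + a)) * (α ^ 2 + β ^ 2) + (3 * b - 4 * R - 8 * a) * ζ ^ 2
        + 8 * R * g * (α * ζ))) := by
  ring

theorem eval_pictureForm (v : Fin 3 → ℂ) : eval v (pictureForm a b R g) = cubicDisc
    (b * (R * (v 0 ^ 2 + v 1 ^ 2) + v 2 ^ 2))
    ((4 * (g ^ 2 + a) - 2 * b) * R * (v 0 ^ 2 + v 1 ^ 2) + 4 * R ^ 2 * v 1 ^ 2
        + (4 * R + 4 * a - 3 * b) * v 2 ^ 2 + -8 * R * g * (v 0 * v 2))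
    (R * (b - 4 * (g ^ 2 + a)) * (v 0 ^ 2 + v 1 ^ 2) + (3 * b - 4 * R - 8 * a) * v 2 ^ 2
        + 8 * R * g * (v 0 * v 2))
    ((4 * a - b) * v 2 ^ 2) := by
  simp only [pictureForm, eval_cubicDisc, eval_quadForm]
  congr 1 <;> ring

/-- The form vanishes at the directions of the tangent lines of the torus. -/
theorem eval_pictureForm_eq_zero (hb : b ≠ 0) {v : Fin 3 → ℂ} {t : ℂ}
    (h1 : t = R * (v 0 ^ 2 + v 1 ^ 2) + v 2 ^ 2 + 2 * (R * v 0 + g * v 2) + (R + g ^ 2 + a))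
    (h2 : t ^ 2 = b * R * ((1 + v 0) ^ 2 + v 1 ^ 2))
    (h3 : 2 * t * (R * v 0 + g * v 2 + (R + g ^ 2 + a)) = b * R * (v 0 + 1) + t ^ 2) :
    eval v (pictureForm a b R g) = 0 := by
  rw [eval_pictureForm]
  -- The point of tangency is at `s = 1`. The root is chosen so that `l = -2t`, which makes `Q +
  -- l/2` vanish there; then `q_l` is a multiple of `(s - 1)²`.
  have hμ : b * ((1 - 2 * t / b) - 1) = -(2 * t) := by field_simp; ring
  have hb2 : b ^ 2 ≠ 0 := pow_ne_zero 2 hb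
  have hmn : -(2 * t) * (R * v 0 + g * v 2) + b * (R * v 0)
      = -(-(2 * t) * (R + g ^ 2 + a) + b * R + (-(2 * t)) ^ 2 / 4) := by linear_combination -h3
  have hu : -(2 * t) * (R * (v 0 ^ 2 + v 1 ^ 2) + v 2 ^ 2) + b * (R * (v 0 ^ 2 + v 1 ^ 2))
      = -(2 * t) * (R + g ^ 2 + a) + b * R + (-(2 * t)) ^ 2 / 4 := by
    linear_combination 2 * t * h1 - h2 + 2 * h3
  have e1 := cubic_eq a b R g (v 0) (v 1) (v 2) (1 - 2 * t / b)
  have e2 := cubic_eq_derivative a b R g (v 0) (v 1) (v 2) (1 - 2 * t / b)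
  rw [hμ, hmn, hu] at e1 e2
  apply cubicDisc_eq_zero_of_double_root (μ := 1 - 2 * t / b)
  · refine (mul_eq_zero.mp (e1.symm.trans ?_)).resolve_left hb2
    ring
  · refine (mul_eq_zero.mp (e2.symm.trans ?_)).resolve_left hb2
    linear_combination -4 * b * (-(2 * t) * (R + g ^ 2 + a) + b * R + (-(2 * t)) ^ 2 / 4) * h1

/-- A zero of the form is the direction of a line that touches the torus, unless it is isotropic. -/
theorem exists_tangency_of_eval_pictureForm_eq_zero (hb : b ≠ 0) {v : Fin 3 → ℂ}
    (hv : eval v (pictureForm a b R g) = 0) (hE : R * (v 0 ^ 2 + v 1 ^ 2) + v 2 ^ 2 ≠ 0) :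
    ∃ s t : ℂ, t = (R * (v 0 ^ 2 + v 1 ^ 2) + v 2 ^ 2) * s ^ 2 + 2 * (R * v 0 + g * v 2) * s
        + (R + g ^ 2 + a) ∧
      t ^ 2 = b * R * ((v 0 ^ 2 + v 1 ^ 2) * s ^ 2 + 2 * v 0 * s + 1) ∧
      2 * t * ((R * (v 0 ^ 2 + v 1 ^ 2) + v 2 ^ 2) * s + (R * v 0 + g * v 2))
        = b * R * ((v 0 ^ 2 + v 1 ^ 2) * s + v 0) := by
  rw [eval_pictureForm] at hv
  obtain ⟨μ, hμ0, hμ1⟩ := exists_double_root_of_cubicDisc_eq_zero (mul_ne_zero hb hE) hv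
  have e1 := cubic_eq a b R g (v 0) (v 1) (v 2) μ
  have e2 := cubic_eq_derivative a b R g (v 0) (v 1) (v 2) μ
  rw [hμ0] at e1
  rw [hμ1] at e2
  clear hμ0 hμ1 hv
  generalize b * (μ - 1) = l at e1 e2
  set E := R * (v 0 ^ 2 + v 1 ^ 2) + v 2 ^ 2
  set p := R * v 0 + g * v 2
  set q := R + g ^ 2 + a
  set u := l * E + b * (R * (v 0 ^ 2 + v 1 ^ 2)) with hu
  set m := l * p + b * (R * v 0) with hm
  set n := l * q + b * R + l ^ 2 / 4 with hn
  have hun : u * n - m ^ 2 = 0 := by linear_combination e1 / 4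
  have hd : E * n + u * (q + l / 2) - 2 * p * m = 0 := by
    refine (mul_eq_zero.mp (e2.trans (mul_zero _))).resolve_left (mul_ne_zero (by norm_num) hb)
  obtain ⟨s, hs1, hs2, hs3⟩ : ∃ s, u * s + m = 0 ∧ m * s + n = 0 ∧
      E * s ^ 2 + 2 * p * s + q = -l / 2 := by
    -- The wanted `s` is a double root of `q_l` and a root of `Q + l/2`. If `u = 0`, then `q_l`
    -- vanishes identically, the quartic is a square, and any root of `Q + l/2` serves. Otherwise `s
    -- = -m/u`, and `hd` says that `u (Q(s) + l/2) = 0`.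
    by_cases hu0 : u = 0
    · have hm0 : m = 0 := by simpa [hu0] using hun
      have hn0 : n = 0 := by simpa [hu0, hm0, hE] using hd
      obtain ⟨d, hd⟩ := IsAlgClosed.exists_pow_nat_eq (p ^ 2 - E * (q + l / 2)) (n := 2) two_pos
      refine ⟨(-p + d) / E, by simp [hu0, hm0], by simp [hm0, hn0], ?_⟩
      field_simp
      linear_combination 2 * hd
    · have hs1 : u * (-m / u) + m = 0 := by field_simp; ring
      have hs2 : m * (-m / u) + n = 0 := by
        have : u * (m * (-m / u) + n) = 0 := by linear_combination m * hs1 + hun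
        exact (mul_eq_zero.mp this).resolve_left hu0
      refine ⟨-m / u, hs1, hs2, ?_⟩
      generalize -m / u = s at hs1 hs2 ⊢
      have : u * (E * s ^ 2 + 2 * p * s + q - -l / 2) = 0 := by
        linear_combination hd + (E * s + 2 * p) * hs1 - E * hs2
      linear_combination (mul_eq_zero.mp this).resolve_left hu0
  refine ⟨s, -l / 2, hs3.symm, ?_, ?_⟩
  · rw [hu] at hs1; rw [hm] at hs1 hs2; rw [hn] at hs2
    linear_combination l * hs3 - s * hs1 - hs2
  · rw [hu, hm] at hs1
    linear_combination -hs1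

/-- On `ζ = 0` one has `c₀ = 0`, so the discriminant is `c₁² (c₂² - 4 c₃ c₁)`. This line is the test
line for squarefreeness. -/
theorem eval_pictureForm_of_last_eq_zero {v : Fin 3 → ℂ} (hv : v 2 = 0) :
    eval v (pictureForm a b R g) = 16 * R ^ 4 * (b - 4 * (g ^ 2 + a)) ^ 2
      * (v 0 ^ 2 + v 1 ^ 2) ^ 2
      * (((g ^ 2 + a) * (v 0 ^ 2 + v 1 ^ 2) + R * v 1 ^ 2) ^ 2
        - b * R * v 1 ^ 2 * (v 0 ^ 2 + v 1 ^ 2)) := by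
  rw [eval_pictureForm, hv, cubicDisc]
  ring

/-- The Hessian is a combination of the squares of the differentials of `c₁` and `ζ`. The condition
`hab` keeps the second coefficient nonzero, and `hbh` makes the differentials independent. -/
theorem rank_hessian_pictureForm (hR : R ≠ 0) (hab : b ≠ 4 * a) (hbh : b ≠ 4 * (g ^ 2 + a))
    {v : Fin 3 → ℂ} (hv : v 2 = 0) (hS : v 0 ^ 2 + v 1 ^ 2 = 0) (h0 : v 0 ≠ 0) :
    (hessian (pictureForm a b R g) v).rank = 2 := by
  have h1 : v 1 ≠ 0 := by
    intro h; rw [h] at hS; exact h0 (by simpa using hS)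
  set k : ℂ := 4 * R ^ 2 * v 1 ^ 2 with hk
  have hk0 : k ≠ 0 := by
    rw [hk]
    exact mul_ne_zero (mul_ne_zero (by norm_num) (pow_ne_zero 2 hR)) (pow_ne_zero 2 h1)
  -- The rows are the gradients of `c₁` and `ζ` at `v`, completed to a basis.
  set U : Matrix (Fin 3) (Fin 3) ℂ :=
    !![2 * (R * (b - 4 * (g ^ 2 + a))) * v 0, 2 * (R * (b - 4 * (g ^ 2 + a))) * v 1, 8 * R * g * v 0;
      0, 0, 1; 0, 1, 0] with hU
  have hdet : U.det ≠ 0 := by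
    have : U.det = -(2 * (R * (b - 4 * (g ^ 2 + a))) * v 0) := by
      simp [hU, Matrix.det_fin_three]
    rw [this]
    exact neg_ne_zero.mpr
      (mul_ne_zero (mul_ne_zero two_ne_zero (mul_ne_zero hR (sub_ne_zero.mpr hbh))) h0)
  have hH : hessian (pictureForm a b R g) v
      = Uᵀ * Matrix.diagonal ![2 * k ^ 2, -(4 * k ^ 3 * (2 * (4 * a - b))), 0] * U := by
    ext i j
    rw [pictureForm, hessian_cubicDisc]
    · have hc : eval v (quadForm ((4 * (g ^ 2 + a) - 2 * b) * R) (4 * R ^ 2) (4 * R + 4 * a - 3 * b)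
          (-8 * R * g)) = k := by
        rw [eval_quadForm, hv, hS, hk]; ring
      rw [hc]
      have n1 : pderiv 0 (X 2 : MvPolynomial (Fin 3) ℂ) = 0 := pderiv_X_of_ne (by decide)
      have n2 : pderiv 1 (X 2 : MvPolynomial (Fin 3) ℂ) = 0 := pderiv_X_of_ne (by decide)
      fin_cases i <;> fin_cases j <;>
      simp [pderiv_zero_quadForm, pderiv_one_quadForm, pderiv_two_quadForm, hU, Matrix.mul_apply,
        Fin.sum_univ_three, Matrix.diagonal, hv, n1, n2] <;> ring
    · rw [eval_quadForm, hv, hS]; ring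
    · rw [eval_quadForm, hv, hS]; ring
    · rw [eval_quadForm, hv]; ring
    · intro i
      fin_cases i <;> simp [pderiv_zero_quadForm, pderiv_one_quadForm, pderiv_two_quadForm, hv]
  rw [hH, Matrix.rank_mul_eq_left_of_isUnit_det _ _ (IsUnit.mk0 _ hdet),
    Matrix.rank_mul_eq_right_of_isUnit_det _ _ (by rw [Matrix.det_transpose]; exact IsUnit.mk0 _ hdet),
    Matrix.rank_diagonal]
  have e : ∀ i : Fin 3, (![2 * k ^ 2, -(4 * k ^ 3 * (2 * (4 * a - b))), 0] i ≠ 0) ↔ i ≠ 2 := by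
    have : 4 * a - b ≠ 0 := sub_ne_zero.mpr hab.symm
    intro i
    fin_cases i <;> simp [hk0, this]
  simp only [e]
  rfl

theorem eval_pderiv_pictureForm_eq_zero {v : Fin 3 → ℂ} (hv : v 2 = 0)
    (hS : v 0 ^ 2 + v 1 ^ 2 = 0) (i : Fin 3) : eval v (pderiv i (pictureForm a b R g)) = 0 := by
  have h3 : eval v (quadForm (b * R) 0 b 0) = 0 := by rw [eval_quadForm, hv, hS]; ring
  have h1 : eval v (quadForm (R * (b - 4 * (g ^ 2 + a))) 0 (3 * b - 4 * R - 8 * a) (8 * R * g))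
      = 0 := by rw [eval_quadForm, hv, hS]; ring
  have h0 : eval v (quadForm 0 0 (4 * a - b) 0) = 0 := by rw [eval_quadForm, hv]; ring
  have hd : eval v (pderiv i (quadForm 0 0 (4 * a - b) 0)) = 0 := by
    fin_cases i <;> simp [pderiv_zero_quadForm, pderiv_one_quadForm, pderiv_two_quadForm, hv]
  rw [pictureForm, pderiv_cubicDisc]
  simp only [map_add, map_sub, map_neg, map_mul, map_pow, h3, h1, h0, hd]
  ring

/-- Away from the circular points only the last factor of the restriction to `ζ = 0` can vanish, and
its roots are simple. The case `α = 0` is excluded because the centre is off the torus, and `β = 0`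
by `hh`. -/
theorem eval_pderiv_pictureForm_ne_zero (hb : b ≠ 0) (hR : R ≠ 0) (hh : g ^ 2 + a ≠ 0)
    (hbh : b ≠ 4 * (g ^ 2 + a)) (hF : (R + g ^ 2 + a) ^ 2 ≠ b * R) {v : Fin 3 → ℂ} (hv : v 2 = 0)
    (h0 : eval v (pictureForm a b R g) = 0) (hS : v 0 ^ 2 + v 1 ^ 2 ≠ 0) :
    ¬ ∀ i, eval v (pderiv i (pictureForm a b R g)) = 0 := by
  intro hd
  have hbh' : b - 4 * (g ^ 2 + a) ≠ 0 := sub_ne_zero.mpr hbh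
  rw [eval_pictureForm_of_last_eq_zero hv] at h0
  have hc : 16 * R ^ 4 * (b - 4 * (g ^ 2 + a)) ^ 2 * (v 0 ^ 2 + v 1 ^ 2) ^ 2 ≠ 0 :=
    mul_ne_zero (mul_ne_zero (mul_ne_zero (by norm_num) (pow_ne_zero 4 hR)) (pow_ne_zero 2 hbh'))
      (pow_ne_zero 2 hS)
  have hT := (mul_eq_zero.mp h0).resolve_left hc
  have d0 := hd 0
  have d1 := hd 1
  rw [pictureForm, pderiv_cubicDisc] at d0 d1
  simp only [pderiv_zero_quadForm, pderiv_one_quadForm, map_add, map_sub, map_neg, map_mul, map_pow,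
    eval_quadForm, eval_X, eval_C, map_ofNat, hv] at d0 d1
  set h := g ^ 2 + a
  set S := v 0 ^ 2 + v 1 ^ 2 with hSdef
  have p0 : v 0 * (2 * h * (h * S + R * v 1 ^ 2) - b * R * v 1 ^ 2) = 0 := by
    refine (mul_eq_zero.mp (?_ : (16 * R ^ 4 * (b - 4 * h) ^ 2 * S ^ 2) * 2 * _ = 0)).resolve_left
      (mul_ne_zero hc two_ne_zero)
    linear_combination d0 - 64 * R ^ 4 * (b - 4 * h) ^ 2 * S * v 0 * hT
  have p1 : v 1 * (2 * (h + R) * (h * S + R * v 1 ^ 2) - b * R * (S + v 1 ^ 2)) = 0 := by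
    refine (mul_eq_zero.mp (?_ : (16 * R ^ 4 * (b - 4 * h) ^ 2 * S ^ 2) * 2 * _ = 0)).resolve_left
      (mul_ne_zero hc two_ne_zero)
    linear_combination d1 - 64 * R ^ 4 * (b - 4 * h) ^ 2 * S * v 1 * hT
  rcases mul_eq_zero.mp p0 with q0 | q0
  · have e : S = v 1 ^ 2 := by rw [hSdef, q0]; ring
    rw [e] at hT hS
    have : (v 1 ^ 2) ^ 2 * ((R + g ^ 2 + a) ^ 2 - b * R) = 0 := by linear_combination hT
    exact (mul_ne_zero (pow_ne_zero 2 hS) (sub_ne_zero.mpr hF)) this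
  rcases mul_eq_zero.mp p1 with q1 | q1
  · rw [q1] at hT
    have : h ^ 2 * S ^ 2 = 0 := by linear_combination hT
    exact (mul_ne_zero (pow_ne_zero 2 hh) (pow_ne_zero 2 hS)) this
  · have : R * (b * (b - 4 * h) * S) = 0 := by
      linear_combination (-2 * R - (2 * h - b)) * q0 + (2 * h - b) * q1
    exact mul_ne_zero hR (mul_ne_zero (mul_ne_zero hb hbh') hS) this

theorem pictureForm_ne_zero (hR : R ≠ 0) (hh : g ^ 2 + a ≠ 0) (hbh : b ≠ 4 * (g ^ 2 + a)) :
    pictureForm a b R g ≠ 0 := by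
  intro h
  have h1 := eval_pictureForm_of_last_eq_zero (a := a) (b := b) (R := R) (g := g)
    (v := ![1, 0, 0]) rfl
  rw [h] at h1
  simp only [map_zero, Matrix.cons_val_zero, Matrix.cons_val_one] at h1
  have : 16 * R ^ 4 * (b - 4 * (g ^ 2 + a)) ^ 2 * (g ^ 2 + a) ^ 2 = 0 := by linear_combination -h1
  exact mul_ne_zero (mul_ne_zero (mul_ne_zero (by norm_num) (pow_ne_zero 4 hR))
    (pow_ne_zero 2 (sub_ne_zero.mpr hbh))) (pow_ne_zero 2 hh) this

/-- A repeated factor would meet the line `ζ = 0`, but the only singular points there are the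
circular points, with Hessian of rank two. -/
theorem squarefree_pictureForm (hb : b ≠ 0) (hR : R ≠ 0) (hh : g ^ 2 + a ≠ 0)
    (hab : b ≠ 4 * a) (hbh : b ≠ 4 * (g ^ 2 + a)) (hF : (R + g ^ 2 + a) ^ 2 ≠ b * R) :
    Squarefree (pictureForm a b R g) := by
  refine squarefree_of_hessian (isHomogeneous_pictureForm a b R g) (pictureForm_ne_zero hR hh hbh)
    ![1, 0, 0] ![0, 1, 0] fun s t hst h0 hd => ?_
  have hv : s • ![1, 0, 0] + t • ![0, 1, 0] = ![s, t, 0] := by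
    ext i; fin_cases i <;> simp
  rw [hv] at h0 hd ⊢
  by_cases hS : s ^ 2 + t ^ 2 = 0
  · refine (rank_hessian_pictureForm hR hab hbh rfl hS ?_).ge
    rintro (rfl : s = 0)
    exact hst.elim (· rfl) (· (by simpa using hS))
  · exact absurd hd (eval_pderiv_pictureForm_ne_zero hb hR hh hbh hF rfl h0 hS)

/-- The picture has no component in common with the projection of the axis of the torus. -/
theorem isRelPrime_pictureForm_X (hR : R ≠ 0) (hh : g ^ 2 + a ≠ 0) (hbh : b ≠ 4 * (g ^ 2 + a)) :
    IsRelPrime (pictureForm a b R g) (X 1) := by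
  refine isRelPrime_of_no_common_zero (isHomogeneous_pictureForm a b R g)
    (pictureForm_ne_zero hR hh hbh) ![1, 0, 0] ![0, 1, 0] fun s t hst h0 h1 => ?_
  have hv : s • ![1, 0, 0] + t • ![0, 1, 0] = ![s, t, 0] := by
    ext i; fin_cases i <;> simp
  rw [hv] at h0 h1
  have ht : t = 0 := by simpa using h1
  subst ht
  have hs : s ≠ 0 := hst.resolve_right (· rfl)
  rw [eval_pictureForm_of_last_eq_zero rfl] at h0
  simp only [Matrix.cons_val_zero, Matrix.cons_val_one] at h0
  have : 16 * R ^ 4 * (b - 4 * (g ^ 2 + a)) ^ 2 * (g ^ 2 + a) ^ 2 * s ^ 8 = 0 := by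
    linear_combination h0
  exact mul_ne_zero (mul_ne_zero (mul_ne_zero (mul_ne_zero (by norm_num) (pow_ne_zero 4 hR))
    (pow_ne_zero 2 (sub_ne_zero.mpr hbh))) (pow_ne_zero 2 hh)) (pow_ne_zero 8 hs) this

/-- The picture has no component in common with the elliptic absolute. -/
theorem isRelPrime_pictureForm_quadForm (hR : R ≠ 0) (hh : g ^ 2 + a ≠ 0)
    (hbh : b ≠ 4 * (g ^ 2 + a))
    (h1 : ∀ z : ℂ, z ^ 2 = -R → 4 * (g - z) ^ 2 + b ≠ 0)
    (h2 : ∀ z : ℂ, z ^ 2 = -R → 4 * (g - z) ^ 2 + 4 * a ≠ 0) :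
    IsRelPrime (pictureForm a b R g) (quadForm R 0 1 0) := by
  refine isRelPrime_of_no_common_zero (isHomogeneous_pictureForm a b R g)
    (pictureForm_ne_zero hR hh hbh) ![1, 0, 0] ![0, 0, 1] fun s t hst h0 hE => ?_
  have hv : s • ![1, 0, 0] + t • ![0, 0, 1] = ![s, 0, t] := by
    ext i; fin_cases i <;> simp
  rw [hv] at h0 hE
  rw [eval_quadForm] at hE
  rw [eval_pictureForm] at h0
  simp only [Matrix.cons_val] at h0 hE
  have hs : s ≠ 0 := by
    rintro rfl
    exact hst.elim (· rfl) (· (by simpa using hE))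
  -- On the test line `β = 0` the isotropic directions are `ζ = z α` with `z² = -R`.
  obtain ⟨z, rfl⟩ : ∃ z, t = z * s := ⟨t / s, by field_simp⟩
  have hz : z ^ 2 = -R := by
    have : s ^ 2 * (z ^ 2 + R) = 0 := by linear_combination hE
    linear_combination (mul_eq_zero.mp this).resolve_left (pow_ne_zero 2 hs)
  have hR' : R = -z ^ 2 := by linear_combination hz
  have : s ^ 8 * R ^ 4 * (4 * (g - z) ^ 2 + b) ^ 2 * (4 * (g - z) ^ 2 + 4 * a) ^ 2 = 0 := by
    rw [← h0, hR', cubicDisc]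
    ring
  exact mul_ne_zero (mul_ne_zero (mul_ne_zero (pow_ne_zero 8 hs) (pow_ne_zero 4 hR))
    (pow_ne_zero 2 (h1 z hz))) (pow_ne_zero 2 (h2 z hz)) this

/-- A polynomial that vanishes at the non-isotropic zeros of the form outside the projection of
the axis vanishes at all its zeros. -/
theorem pictureForm_dvd (hb : b ≠ 0) (hR : R ≠ 0) (hh : g ^ 2 + a ≠ 0)
    (hab : b ≠ 4 * a) (hbh : b ≠ 4 * (g ^ 2 + a)) (hF : (R + g ^ 2 + a) ^ 2 ≠ b * R)
    (h1 : ∀ z : ℂ, z ^ 2 = -R → 4 * (g - z) ^ 2 + b ≠ 0)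
    (h2 : ∀ z : ℂ, z ^ 2 = -R → 4 * (g - z) ^ 2 + 4 * a ≠ 0)
    {K : MvPolynomial (Fin 3) ℂ}
    (hK : ∀ v, eval v (pictureForm a b R g) = 0 → v 1 ≠ 0 →
      R * (v 0 ^ 2 + v 1 ^ 2) + v 2 ^ 2 ≠ 0 → eval v K = 0) :
    pictureForm a b R g ∣ K := by
  have hsq := squarefree_pictureForm hb hR hh hab hbh hF
  -- The two extra factors kill the excluded zeros. The Nullstellensatz applies, and squarefreeness
  -- makes the ideal radical.
  have hdvd : pictureForm a b R g ∣ K * quadForm R 0 1 0 * X 1 := by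
    have hmem : K * quadForm R 0 1 0 * X 1
        ∈ vanishingIdeal ℂ (zeroLocus ℂ (Ideal.span {pictureForm a b R g})) := by
      intro v hv
      have hv0 : eval v (pictureForm a b R g) = 0 := by
        have := hv _ (Ideal.mem_span_singleton_self _)
        rwa [aeval_eq_eval] at this
      rw [aeval_eq_eval]
      change eval v _ = 0
      rw [map_mul, map_mul, eval_quadForm, eval_X]
      by_cases hv1 : v 1 = 0
      · rw [hv1, mul_zero]
      by_cases hE : R * (v 0 ^ 2 + v 1 ^ 2) + v 2 ^ 2 = 0
      · rw [show R * (v 0 ^ 2 + v 1 ^ 2) + 0 * v 1 ^ 2 + 1 * v 2 ^ 2 + 0 * (v 0 * v 2) = 0 by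
          linear_combination hE, mul_zero, zero_mul]
      · rw [hK v hv0 hv1 hE, zero_mul, zero_mul]
    rw [vanishingIdeal_zeroLocus_eq_radical, Ideal.mem_radical_iff] at hmem
    obtain ⟨n, hn⟩ := hmem
    rw [Ideal.mem_span_singleton] at hn
    exact hsq.isRadical n _ hn
  exact (isRelPrime_pictureForm_quadForm hR hh hbh h1 h2).dvd_of_dvd_mul_right
    ((isRelPrime_pictureForm_X hR hh hbh).dvd_of_dvd_mul_right hdvd)

end PictureForm

/-! ### Derivatives and singular points of the torus -/

section Torus

open MvPolynomial

variable {a b : ℝ}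

theorem isHomogeneous_torusForm (a b : ℝ) : (torusForm a b).IsHomogeneous 4 := by
  have hX : ∀ i : Fin 4, (X i ^ 2 : MvPolynomial (Fin 4) ℂ).IsHomogeneous 2 :=
    fun i => isHomogeneous_X_pow i 2
  exact (((((hX 0).add (hX 1)).add (hX 2)).add ((hX 3).C_mul _)).pow 2).sub
    ((((hX 0).add (hX 1)).C_mul _).mul (hX 3))

theorem eval_torusForm (v : Fin 4 → ℂ) : eval v (torusForm a b)
    = (v 0 ^ 2 + v 1 ^ 2 + v 2 ^ 2 + a * v 3 ^ 2) ^ 2 - b * (v 0 ^ 2 + v 1 ^ 2) * v 3 ^ 2 := by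
  simp [torusForm]

theorem eval_pderiv_torusForm (v : Fin 4 → ℂ) (i : Fin 4) :
    eval v (pderiv i (torusForm a b))
    = ![4 * (v 0 ^ 2 + v 1 ^ 2 + v 2 ^ 2 + a * v 3 ^ 2) * v 0 - 2 * b * v 0 * v 3 ^ 2,
        4 * (v 0 ^ 2 + v 1 ^ 2 + v 2 ^ 2 + a * v 3 ^ 2) * v 1 - 2 * b * v 1 * v 3 ^ 2,
        4 * (v 0 ^ 2 + v 1 ^ 2 + v 2 ^ 2 + a * v 3 ^ 2) * v 2,
        4 * a * (v 0 ^ 2 + v 1 ^ 2 + v 2 ^ 2 + a * v 3 ^ 2) * v 3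
          - 2 * b * (v 0 ^ 2 + v 1 ^ 2) * v 3] i := by
  fin_cases i <;>
  · simp [torusForm, pderiv_X]
    ring

/-- The polar form of the torus with respect to the point `o`, at `v`. -/
theorem sum_eval_pderiv_torusForm (v o : Fin 4 → ℂ) :
    ∑ i, eval v (pderiv i (torusForm a b)) * o i
    = 4 * (v 0 ^ 2 + v 1 ^ 2 + v 2 ^ 2 + a * v 3 ^ 2)
        * (o 0 * v 0 + o 1 * v 1 + o 2 * v 2 + a * o 3 * v 3)
      - 2 * b * (o 0 * v 0 + o 1 * v 1) * v 3 ^ 2 - 2 * b * (v 0 ^ 2 + v 1 ^ 2) * v 3 * o 3 := by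
  simp only [Fin.sum_univ_four, eval_pderiv_torusForm, Matrix.cons_val]
  ring

/-- The affine singular points of the torus lie on its axis. -/
theorem eq_zero_of_eval_pderiv_torusForm_eq_zero (hb : b ≠ 0) (hab : b ≠ 4 * a) {v : Fin 4 → ℂ}
    (hv : v 3 = 1) (h : ∀ i, eval v (pderiv i (torusForm a b)) = 0) : v 0 = 0 ∧ v 1 = 0 := by
  have hbC : (b : ℂ) ≠ 0 := by exact_mod_cast hb
  have habC : (b : ℂ) ≠ 4 * a := by exact_mod_cast hab
  have h0 := h 0
  have h1 := h 1
  have h2 := h 2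
  have h3 := h 3
  simp only [eval_pderiv_torusForm, Matrix.cons_val, hv] at h0 h1 h2 h3
  -- If `2Q = b`, the `z`-derivative gives `z = 0` and the `w`-derivative gives `x² + y² = a`,
  -- whence `b = 4a`.
  by_cases hQ : 2 * (v 0 ^ 2 + v 1 ^ 2 + v 2 ^ 2 + a) - b = (0 : ℂ)
  · exfalso
    have h2' : v 2 = 0 := by
      have : 2 * (b : ℂ) * v 2 = 0 := by linear_combination h2 - 2 * v 2 * hQ
      exact (mul_eq_zero.mp this).resolve_left (mul_ne_zero two_ne_zero hbC)
    rw [h2'] at hQ h3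
    have h3' : (v 0 ^ 2 + v 1 ^ 2 - a : ℂ) = 0 := by
      have : 2 * (b : ℂ) * (v 0 ^ 2 + v 1 ^ 2 - a) = 0 := by linear_combination -h3 + 2 * a * hQ
      exact (mul_eq_zero.mp this).resolve_left (mul_ne_zero two_ne_zero hbC)
    exact habC (by linear_combination 2 * h3' - hQ)
  · constructor
    · have : 2 * (2 * (v 0 ^ 2 + v 1 ^ 2 + v 2 ^ 2 + a) - b) * v 0 = 0 := by linear_combination h0
      exact (mul_eq_zero.mp this).resolve_left (mul_ne_zero two_ne_zero hQ)
    · have : 2 * (2 * (v 0 ^ 2 + v 1 ^ 2 + v 2 ^ 2 + a) - b) * v 1 = 0 := by linear_combination h1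
      exact (mul_eq_zero.mp this).resolve_left (mul_ne_zero two_ne_zero hQ)

end Torus

/-! ### Central projections and their critical points -/

section Projection

open MvPolynomial

/-- The directions with coordinates `α`, `β`, `ζ`, as points at infinity. -/
def directionMatrix {A : Type*} [Ring A] (x₀ y₀ : A) : Matrix (Fin 4) (Fin 3) A :=
  !![x₀, -y₀, 0; y₀, x₀, 0; 0, 0, 1; 0, 0, 0]

theorem directionMatrix_mulVec {A : Type*} [Ring A] (x₀ y₀ : A) (v : Fin 3 → A) :
    directionMatrix x₀ y₀ *ᵥ v
      = ![x₀ * v 0 - y₀ * v 1, y₀ * v 0 + x₀ * v 1, v 2, 0] := by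
  ext i
  fin_cases i <;>
    simp [directionMatrix, Matrix.mulVec, dotProduct, Fin.sum_univ_three, sub_eq_add_neg]

/-- A point is the sum of a multiple of the centre and a point at infinity. -/
theorem exists_eq_smul_add_directionMatrix_mulVec {K : Type*} [Field K] {x₀ y₀ g : K}
    (hR : x₀ ^ 2 + y₀ ^ 2 ≠ 0) (w : Fin 4 → K) :
    ∃ v, w = w 3 • ![x₀, y₀, g, 1] + directionMatrix x₀ y₀ *ᵥ v := by
  refine ⟨![(x₀ * (w 0 - w 3 * x₀) + y₀ * (w 1 - w 3 * y₀)) / (x₀ ^ 2 + y₀ ^ 2),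
    (x₀ * (w 1 - w 3 * y₀) - y₀ * (w 0 - w 3 * x₀)) / (x₀ ^ 2 + y₀ ^ 2), w 2 - w 3 * g], ?_⟩
  rw [directionMatrix_mulVec]
  ext i
  fin_cases i <;> simp <;> field_simp <;> ring

/-- A central projection with centre `(x₀, y₀, g, 1)` is injective on the plane at infinity. -/
theorem det_mul_directionMatrix_ne_zero {x₀ y₀ g : ℝ} (hR : x₀ ^ 2 + y₀ ^ 2 ≠ 0)
    {P : Matrix (Fin 3) (Fin 4) ℝ} (hP : P.rank = 3) (ho : P *ᵥ ![x₀, y₀, g, 1] = 0) :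
    (P * directionMatrix x₀ y₀).det ≠ 0 := by
  intro hdet
  obtain ⟨v, hv0, hv⟩ := Matrix.exists_mulVec_eq_zero_iff.mpr hdet
  rw [← Matrix.mulVec_mulVec] at hv
  have hker : Module.finrank ℝ (LinearMap.ker P.mulVecLin) = 1 := by
    have := LinearMap.finrank_range_add_finrank_ker P.mulVecLin
    rw [← Matrix.rank, hP] at this
    simp at this
    omega
  have ho' : (⟨![x₀, y₀, g, 1], by simpa using ho⟩ : LinearMap.ker P.mulVecLin) ≠ 0 := by
    intro h
    have := congrFun (congrArg Subtype.val h) 3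
    simp at this
  obtain ⟨c, hc⟩ := (finrank_eq_one_iff_of_nonzero' _ ho').mp hker
    ⟨directionMatrix x₀ y₀ *ᵥ v, by simpa using hv⟩
  have hc' : c • ![x₀, y₀, g, 1] = directionMatrix x₀ y₀ *ᵥ v := congrArg Subtype.val hc
  rw [directionMatrix_mulVec] at hc'
  have c3 := congrFun hc' 3
  have c0 := congrFun hc' 0
  have c1 := congrFun hc' 1
  have c2 := congrFun hc' 2
  simp at c3
  simp [c3] at c0 c1 c2
  apply hv0
  have e0 : (x₀ ^ 2 + y₀ ^ 2) * v 0 = 0 := by linear_combination -x₀ * c0 - y₀ * c1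
  have e1 : (x₀ ^ 2 + y₀ ^ 2) * v 1 = 0 := by linear_combination y₀ * c0 - x₀ * c1
  ext i
  fin_cases i
  · exact (mul_eq_zero.mp e0).resolve_left hR
  · exact (mul_eq_zero.mp e1).resolve_left hR
  · exact c2.symm

/-- The image of a hyperplane under a projection is everything unless the hyperplane contains
the centre. -/
theorem map_ker_ne_top_iff {E E' : Type*} [AddCommGroup E] [Module ℂ E] [AddCommGroup E']
    [Module ℂ E'] {φ : E →ₗ[ℂ] E'} (hφ : Function.Surjective φ) {o : E} (ho : φ o = 0)
    (hker : ∀ w, φ w = 0 → ∃ c : ℂ, w = c • o) {l : E →ₗ[ℂ] ℂ} (hl : l ≠ 0) :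
    (LinearMap.ker l).map φ ≠ ⊤ ↔ l o = 0 := by
  constructor
  · intro h
    by_contra hlo
    apply h
    rw [eq_top_iff]
    intro y _
    obtain ⟨w, rfl⟩ := hφ y
    refine ⟨w - (l w / l o) • o, ?_, by simp [ho]⟩
    simp [hlo]
  · intro h htop
    obtain ⟨w, hw⟩ : ∃ w, l w ≠ 0 := by
      by_contra! h'
      exact hl (LinearMap.ext h')
    obtain ⟨w', hw', he⟩ : φ w ∈ (LinearMap.ker l).map φ := by rw [htop]; trivial
    obtain ⟨c, hc⟩ := hker (w - w') (by rw [map_sub, he, sub_self])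
    apply hw
    have := congrArg l hc
    rwa [map_sub, map_smul, h, smul_zero, LinearMap.mem_ker.mp hw', sub_zero] at this

end Projection

/-! ### The picture and its nodes in the image plane -/

/-- The data of a central projection with centre `(x₀, y₀, g, 1)`, in the coordinates of
`directionMatrix`. -/
structure ProjectionData (P : Matrix (Fin 3) (Fin 4) ℝ) (x₀ y₀ g : ℝ) where
  /-- The matrix of the projection on the plane at infinity. -/
  B : Matrix (Fin 3) (Fin 3) ℂ
  /-- The inverse matrix. -/
  N : Matrix (Fin 3) (Fin 3) ℂ
  mul_eq_one : B * N = 1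
  map_center : projLin P ![(x₀ : ℂ), y₀, g, 1] = 0
  map_direction : ∀ v, projLin P (directionMatrix (x₀ : ℂ) y₀ *ᵥ v) = B *ᵥ v

theorem nonempty_projectionData {P : Matrix (Fin 3) (Fin 4) ℝ} {x₀ y₀ g : ℝ}
    (hR : x₀ ^ 2 + y₀ ^ 2 ≠ 0) (hP : P.rank = 3) (ho : P *ᵥ ![x₀, y₀, g, 1] = 0) :
    Nonempty (ProjectionData P x₀ y₀ g) := by
  have hdet := det_mul_directionMatrix_ne_zero hR hP ho
  set M := P * directionMatrix x₀ y₀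
  have hMC : (M.map (algebraMap ℝ ℂ)) = P.map (algebraMap ℝ ℂ) * directionMatrix (x₀ : ℂ) y₀ := by
    rw [Matrix.map_mul]
    congr 1
    ext i j
    fin_cases i <;> fin_cases j <;> simp [directionMatrix]
  refine ⟨⟨M.map (algebraMap ℝ ℂ), (M⁻¹).map (algebraMap ℝ ℂ), ?_, ?_, ?_⟩⟩
  · rw [← Matrix.map_mul, Matrix.mul_nonsing_inv _ (IsUnit.mk0 _ hdet),
      Matrix.map_one _ (map_zero _) (map_one _)]
  · rw [projLin, Matrix.toLin'_apply]
    have h : ![(x₀ : ℂ), y₀, g, 1] = (algebraMap ℝ ℂ) ∘ ![x₀, y₀, g, 1] := by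
      ext i; fin_cases i <;> simp
    rw [h]
    ext i
    rw [← RingHom.map_mulVec, ho]
    simp
  · intro v
    rw [projLin, Matrix.toLin'_apply, Matrix.mulVec_mulVec, hMC]

open MvPolynomial

namespace ProjectionData

variable {P : Matrix (Fin 3) (Fin 4) ℝ} {x₀ y₀ g : ℝ} {a b : ℝ}

theorem mul_eq_one' (D : ProjectionData P x₀ y₀ g)
    : D.N * D.B = 1 := mul_eq_one_comm.mp D.mul_eq_one

theorem N_mulVec_B_mulVec (D : ProjectionData P x₀ y₀ g) (v : Fin 3 → ℂ) : D.N *ᵥ D.B *ᵥ v = v := by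
  rw [Matrix.mulVec_mulVec, D.mul_eq_one', Matrix.one_mulVec]

theorem B_mulVec_N_mulVec (D : ProjectionData P x₀ y₀ g) (v : Fin 3 → ℂ) : D.B *ᵥ D.N *ᵥ v = v := by
  rw [Matrix.mulVec_mulVec, D.mul_eq_one, Matrix.one_mulVec]

theorem B_mulVec_ne_zero (D : ProjectionData P x₀ y₀ g)
    {v : Fin 3 → ℂ} (hv : v ≠ 0) : D.B *ᵥ v ≠ 0 := by
  intro h
  apply hv
  rw [← D.N_mulVec_B_mulVec v, h, Matrix.mulVec_zero]

theorem projLin_eq (D : ProjectionData P x₀ y₀ g) (c : ℂ) (v : Fin 3 → ℂ) :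
    projLin P (c • ![(x₀ : ℂ), y₀, g, 1] + directionMatrix (x₀ : ℂ) y₀ *ᵥ v) = D.B *ᵥ v := by
  rw [map_add, map_smul, D.map_center, smul_zero, zero_add, D.map_direction]

theorem projLin_surjective (D : ProjectionData P x₀ y₀ g)
    : Function.Surjective (projLin P) := fun y =>
  ⟨directionMatrix (x₀ : ℂ) y₀ *ᵥ D.N *ᵥ y, by rw [D.map_direction, D.B_mulVec_N_mulVec]⟩

theorem exists_eq (D : ProjectionData P x₀ y₀ g)
    (hR : (x₀ : ℂ) ^ 2 + (y₀ : ℂ) ^ 2 ≠ 0) (w : Fin 4 → ℂ) :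
    ∃ v, w = w 3 • ![(x₀ : ℂ), y₀, g, 1] + directionMatrix (x₀ : ℂ) y₀ *ᵥ v ∧
      projLin P w = D.B *ᵥ v := by
  obtain ⟨v, hv⟩ := exists_eq_smul_add_directionMatrix_mulVec (g := (g : ℂ)) hR w
  exact ⟨v, hv, (congrArg (projLin P) hv).trans (D.projLin_eq _ _)⟩

theorem exists_eq_smul_of_projLin_eq_zero (D : ProjectionData P x₀ y₀ g)
    (hR : (x₀ : ℂ) ^ 2 + (y₀ : ℂ) ^ 2 ≠ 0)
    (w : Fin 4 → ℂ) (hw : projLin P w = 0) : ∃ c : ℂ, w = c • ![(x₀ : ℂ), y₀, g, 1] := by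
  obtain ⟨v, hv, hPv⟩ := D.exists_eq hR w
  have hv0 : v = 0 := by
    rw [← D.N_mulVec_B_mulVec v, ← hPv, hw, Matrix.mulVec_zero]
  exact ⟨w 3, by rw [hv0, Matrix.mulVec_zero, add_zero] at hv; exact hv⟩

/-- A smooth point is critical if and only if the tangent plane contains the centre. -/
theorem map_coneTangent_ne_top_iff (D : ProjectionData P x₀ y₀ g)
    (hR : (x₀ : ℂ) ^ 2 + (y₀ : ℂ) ^ 2 ≠ 0)
    {F : MvPolynomial (Fin 4) ℂ} {w : Fin 4 → ℂ} (hw : ∃ i, eval w (pderiv i F) ≠ 0) :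
    (coneTangent F w).map (projLin P) ≠ ⊤ ↔
      ∑ i, eval w (pderiv i F) * ![(x₀ : ℂ), y₀, g, 1] i = 0 := by
  rw [coneTangent, map_ker_ne_top_iff D.projLin_surjective D.map_center
    (D.exists_eq_smul_of_projLin_eq_zero hR)]
  · simp only [LinearMap.sum_apply, LinearMap.smul_apply, LinearMap.proj_apply, smul_eq_mul]
  · obtain ⟨i, hi⟩ := hw
    intro h
    apply hi
    have := LinearMap.congr_fun h (Pi.single i 1)
    simpa [LinearMap.sum_apply, Pi.single_apply] using this

/-- The form that defines the picture. -/
noncomputable def form (D : ProjectionData P x₀ y₀ g) (a b : ℝ) : MvPolynomial (Fin 3) ℂ :=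
  linSubst D.N (pictureForm a b (x₀ ^ 2 + y₀ ^ 2) g)

theorem isHomogeneous_form (D : ProjectionData P x₀ y₀ g) : (D.form a b).IsHomogeneous 8 :=
  isHomogeneous_linSubst _ (isHomogeneous_pictureForm ..)

theorem eval_form (D : ProjectionData P x₀ y₀ g) (v : Fin 3 → ℂ) : eval (D.B *ᵥ v) (D.form a b)
    = eval v (pictureForm a b (x₀ ^ 2 + y₀ ^ 2) g) := by
  rw [form, eval_linSubst, D.N_mulVec_B_mulVec]

theorem projImage_criticalPoints_subset (D : ProjectionData P x₀ y₀ g)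
    (hb : b ≠ 0) (hR : (x₀ : ℂ) ^ 2 + (y₀ : ℂ) ^ 2 ≠ 0) :
    projImage P (criticalPoints P (torusForm a b)) ⊆ zeroSet (D.form a b) := by
  rintro y ⟨x, ⟨⟨hx, hsm⟩, _, hcrit⟩, h0, rfl⟩
  rw [mk_mem_zeroSet_iff D.isHomogeneous_form]
  rw [D.map_coneTangent_ne_top_iff hR hsm, sum_eval_pderiv_torusForm] at hcrit
  obtain ⟨i, hi⟩ := hsm
  change eval x.rep (torusForm a b) = 0 at hx
  rw [eval_torusForm] at hx
  obtain ⟨v, hv, hPv⟩ := D.exists_eq hR x.rep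
  rw [hPv, D.eval_form]
  set w := x.rep
  -- The torus meets `w = 0` only in the absolute, along which it is singular, so smooth points are
  -- finite.
  have hw3 : w 3 ≠ 0 := by
    intro h3
    have hQ : w 0 ^ 2 + w 1 ^ 2 + w 2 ^ 2 + a * w 3 ^ 2 = 0 := by
      rw [h3] at hx ⊢
      exact pow_eq_zero_iff two_ne_zero |>.mp (by linear_combination hx)
    apply hi
    rw [eval_pderiv_torusForm, hQ, h3]
    fin_cases i <;> simp
  set c := w 3 with hc
  -- After rescaling, the critical point is `o + u`, that is, `s = 1` on its line.
  obtain ⟨u, rfl⟩ : ∃ u, v = c • u :=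
    ⟨c⁻¹ • v, by rw [smul_smul, mul_inv_cancel₀ hw3, one_smul]⟩
  rw [eval_smul_of_isHomogeneous (isHomogeneous_pictureForm ..)]
  rw [directionMatrix_mulVec] at hv
  have w0 := congrFun hv 0
  have w1 := congrFun hv 1
  have w2 := congrFun hv 2
  simp only [Pi.add_apply, Pi.smul_apply, smul_eq_mul, Matrix.cons_val] at w0 w1 w2
  rw [w0, w1, w2] at hx
  simp only [Matrix.cons_val] at hcrit
  rw [w0, w1, w2] at hcrit
  set R : ℂ := (x₀ : ℂ) ^ 2 + (y₀ : ℂ) ^ 2 with hRdef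
  obtain ⟨t, ht⟩ : ∃ t : ℂ, t = R * (u 0 ^ 2 + u 1 ^ 2) + u 2 ^ 2 + 2 * (R * u 0 + g * u 2)
    + (R + g ^ 2 + a) := ⟨_, rfl⟩
  have ht2 : t ^ 2 = b * R * ((1 + u 0) ^ 2 + u 1 ^ 2) := by
    have : c ^ 4 * (t ^ 2 - b * R * ((1 + u 0) ^ 2 + u 1 ^ 2)) = 0 := by
      rw [← hx, ht, hRdef]; ring
    linear_combination (mul_eq_zero.mp this).resolve_left (pow_ne_zero 4 hw3)
  have ht3 : 2 * t * (R * u 0 + g * u 2 + (R + g ^ 2 + a)) = b * R * (u 0 + 1) + t ^ 2 := by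
    have : 2 * c ^ 3 * (2 * t * (R * u 0 + g * u 2 + (R + g ^ 2 + a)) - b * R * (u 0 + 1)
        - b * R * ((1 + u 0) ^ 2 + u 1 ^ 2)) = 0 := by
      rw [← hcrit, ht, hRdef]; ring
    linear_combination (mul_eq_zero.mp this).resolve_left
      (mul_ne_zero two_ne_zero (pow_ne_zero 3 hw3)) - ht2
  rw [eval_pictureForm_eq_zero (by exact_mod_cast hb) ht ht2 ht3, mul_zero]

theorem mk_mem_criticalPoints (D : ProjectionData P x₀ y₀ g)
    (hR : (x₀ : ℂ) ^ 2 + (y₀ : ℂ) ^ 2 ≠ 0) {F : MvPolynomial (Fin 4) ℂ}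
    {d : ℕ} (hF : F.IsHomogeneous d) {w : Fin 4 → ℂ} (hw : w ≠ 0) (hFw : eval w F = 0)
    (hsm : ∃ i, eval w (pderiv i F) ≠ 0) (hPw : projLin P w ≠ 0)
    (hpolar : ∑ i, eval w (pderiv i F) * ![(x₀ : ℂ), y₀, g, 1] i = 0) :
    Projectivization.mk ℂ w hw ∈ criticalPoints P F := by
  obtain ⟨c, hc⟩ := Projectivization.exists_smul_eq_mk_rep ℂ w hw
  rw [Units.smul_def] at hc
  have hd : ∀ i, eval (Projectivization.mk ℂ w hw).rep (pderiv i F)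
      = (c : ℂ) ^ (d - 1) * eval w (pderiv i F) := fun i => by
    rw [← hc, eval_smul_of_isHomogeneous hF.pderiv]
  have hsm' : ∃ i, eval (Projectivization.mk ℂ w hw).rep (pderiv i F) ≠ 0 := by
    obtain ⟨i, hi⟩ := hsm
    exact ⟨i, by rw [hd]; exact mul_ne_zero (pow_ne_zero _ c.ne_zero) hi⟩
  refine ⟨⟨(mk_mem_zeroSet_iff hF w hw).mpr hFw, hsm'⟩, ?_, ?_⟩
  · rw [← hc, map_smul]
    exact smul_ne_zero c.ne_zero hPw
  · rw [D.map_coneTangent_ne_top_iff hR hsm']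
    simp only [hd, mul_assoc]
    rw [← Finset.mul_sum, hpolar, mul_zero]

theorem mk_mem_projImage {A : Set (ProjSpace 3)} {w : Fin 4 → ℂ} (hw : w ≠ 0)
    (hA : Projectivization.mk ℂ w hw ∈ A) (hPw : projLin P w ≠ 0) :
    Projectivization.mk ℂ (projLin P w) hPw ∈ projImage P A := by
  obtain ⟨c, hc⟩ := Projectivization.exists_smul_eq_mk_rep ℂ w hw
  rw [Units.smul_def] at hc
  have h : projLin P (Projectivization.mk ℂ w hw).rep = (c : ℂ) • projLin P w := by
    rw [← hc, map_smul]
  refine ⟨_, hA, by rw [h]; exact smul_ne_zero c.ne_zero hPw, ?_⟩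
  rw [Projectivization.mk_eq_mk_iff']
  exact ⟨c, h.symm⟩

theorem mk_mem_projImage_criticalPoints (D : ProjectionData P x₀ y₀ g)
    (hb : b ≠ 0) (hab : b ≠ 4 * a)
    (hR : (x₀ : ℂ) ^ 2 + (y₀ : ℂ) ^ 2 ≠ 0)
    (hF : ((x₀ : ℂ) ^ 2 + (y₀ : ℂ) ^ 2 + g ^ 2 + a) ^ 2 ≠ b * ((x₀ : ℂ) ^ 2 + (y₀ : ℂ) ^ 2))
    {v : Fin 3 → ℂ} (hv : eval v (pictureForm a b (x₀ ^ 2 + y₀ ^ 2) g) = 0) (hv1 : v 1 ≠ 0)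
    (hE : ((x₀ : ℂ) ^ 2 + (y₀ : ℂ) ^ 2) * (v 0 ^ 2 + v 1 ^ 2) + v 2 ^ 2 ≠ 0)
    (hBv : D.B *ᵥ v ≠ 0) :
    Projectivization.mk ℂ (D.B *ᵥ v) hBv ∈ projImage P (criticalPoints P (torusForm a b)) := by
  obtain ⟨s, t, ht1, ht2, ht3⟩ :=
    exists_tangency_of_eval_pictureForm_eq_zero (by exact_mod_cast hb) hv hE
  -- `s = 0` would put the centre on the torus.
  have hs : s ≠ 0 := by
    rintro rfl
    apply hF
    rw [ht1] at ht2
    linear_combination ht2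
  set w : Fin 4 → ℂ := (1 : ℂ) • ![(x₀ : ℂ), y₀, g, 1] + directionMatrix (x₀ : ℂ) y₀ *ᵥ (s • v)
    with hw
  have hPw : projLin P w = s • D.B *ᵥ v := by rw [hw, D.projLin_eq, Matrix.mulVec_smul]
  have hPw0 : projLin P w ≠ 0 := by rw [hPw]; exact smul_ne_zero hs hBv
  have w0 : w 0 = x₀ + s * (x₀ * v 0 - y₀ * v 1) := by
    simp [hw, directionMatrix_mulVec]; ring
  have w1 : w 1 = y₀ + s * (y₀ * v 0 + x₀ * v 1) := by
    simp [hw, directionMatrix_mulVec]; ring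
  have w2 : w 2 = g + s * v 2 := by
    simp [hw, directionMatrix_mulVec]
  have w3 : w 3 = 1 := by
    simp [hw, directionMatrix_mulVec]
  have hw_ne : w ≠ 0 := by
    intro h
    rw [h] at w3
    simp at w3
  have hmem := mk_mem_projImage (P := P) hw_ne (D.mk_mem_criticalPoints hR
    (isHomogeneous_torusForm a b) hw_ne ?_ ?_ hPw0 ?_) hPw0
  · convert hmem using 1
    rw [Projectivization.mk_eq_mk_iff']
    exact ⟨s⁻¹, by rw [hPw, smul_smul, inv_mul_cancel₀ hs, one_smul]⟩
  · rw [eval_torusForm, w0, w1, w2, w3]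
    rw [ht1] at ht2
    linear_combination ht2
  -- Finite singular points lie on the axis, which a line with `β ≠ 0` misses.
  · by_contra! hsing
    obtain ⟨h0, h1⟩ := eq_zero_of_eval_pderiv_torusForm_eq_zero hb hab w3 hsing
    rw [w0] at h0
    rw [w1] at h1
    have : ((x₀ : ℂ) ^ 2 + (y₀ : ℂ) ^ 2) * (s * v 1) = 0 := by linear_combination x₀ * h1 - y₀ * h0
    exact mul_ne_zero hR (mul_ne_zero hs hv1) this
  -- With `o = w - s d`, Euler's formula turns the polar form into `4 F(w)` minus `s` times the
  -- derivative along the line; both vanish.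
  · rw [sum_eval_pderiv_torusForm, w0, w1, w2, w3]
    simp only [Matrix.cons_val]
    rw [ht1] at ht2 ht3
    linear_combination 4 * ht2 - 2 * s * ht3

theorem picture_eq (D : ProjectionData P x₀ y₀ g)
    (hb : b ≠ 0) (hab : b ≠ 4 * a) (hR : (x₀ : ℂ) ^ 2 + (y₀ : ℂ) ^ 2 ≠ 0)
    (hF : ((x₀ : ℂ) ^ 2 + (y₀ : ℂ) ^ 2 + g ^ 2 + a) ^ 2 ≠ b * ((x₀ : ℂ) ^ 2 + (y₀ : ℂ) ^ 2))
    (hdvd : ∀ K : MvPolynomial (Fin 3) ℂ,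
      (∀ v, eval v (pictureForm a b (x₀ ^ 2 + y₀ ^ 2) g) = 0 → v 1 ≠ 0 →
        ((x₀ : ℂ) ^ 2 + (y₀ : ℂ) ^ 2) * (v 0 ^ 2 + v 1 ^ 2) + v 2 ^ 2 ≠ 0 → eval v K = 0) →
      pictureForm a b (x₀ ^ 2 + y₀ ^ 2) g ∣ K) :
    picture P (torusForm a b) = zeroSet (D.form a b) := by
  apply Set.Subset.antisymm
  · intro y hy
    exact hy 8 _ D.isHomogeneous_form (D.projImage_criticalPoints_subset hb hR)
  · intro y hy d K hK hsub
    obtain ⟨A, hA⟩ := hdvd (linSubst D.B K) fun v hv hv1 hE => by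
      have hv0 : v ≠ 0 := by rintro rfl; exact hv1 rfl
      have := hsub (D.mk_mem_projImage_criticalPoints hb hab hR hF hv hv1 hE (D.B_mulVec_ne_zero hv0))
      rwa [mk_mem_zeroSet_iff hK, ← eval_linSubst] at this
    change eval y.rep (D.form a b) = 0 at hy
    change eval y.rep K = 0
    rw [← D.B_mulVec_N_mulVec y.rep] at hy ⊢
    rw [← eval_linSubst, hA, map_mul, ← D.eval_form, hy, zero_mul]

theorem isNode_form (D : ProjectionData P x₀ y₀ g)
    (hab : b ≠ 4 * a) (hR : (x₀ : ℂ) ^ 2 + (y₀ : ℂ) ^ 2 ≠ 0)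
    (hbh : (b : ℂ) ≠ 4 * (g ^ 2 + a)) {v : Fin 3 → ℂ} (hv : v ≠ 0) (hv2 : v 2 = 0)
    (hS : v 0 ^ 2 + v 1 ^ 2 = 0) :
    IsNode (D.form a b) (Projectivization.mk ℂ (D.B *ᵥ v) (D.B_mulVec_ne_zero hv)) := by
  have hv0 : v 0 ≠ 0 := by
    intro h
    rw [h] at hS
    apply hv
    ext i
    fin_cases i
    · exact h
    · exact pow_eq_zero_iff two_ne_zero |>.mp (show v 1 ^ 2 = 0 by linear_combination hS)
    · exact hv2
  obtain ⟨c, hc⟩ := Projectivization.exists_smul_eq_mk_rep ℂ (D.B *ᵥ v) (D.B_mulVec_ne_zero hv)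
  rw [Units.smul_def, ← Matrix.mulVec_smul] at hc
  have hc2 : ((c : ℂ) • v) 2 = 0 := by rw [Pi.smul_apply, hv2, smul_zero]
  have hcS : ((c : ℂ) • v) 0 ^ 2 + ((c : ℂ) • v) 1 ^ 2 = 0 := by
    simp only [Pi.smul_apply, smul_eq_mul]
    linear_combination (c : ℂ) ^ 2 * hS
  refine ⟨?_, fun i => ?_, ?_⟩
  · rw [mk_mem_zeroSet_iff D.isHomogeneous_form, D.eval_form, eval_pictureForm_of_last_eq_zero hv2,
      hS]
    ring
  · rw [← hc, form, pderiv_linSubst, map_sum]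
    refine Finset.sum_eq_zero fun j _ => ?_
    rw [map_mul, eval_linSubst, D.N_mulVec_B_mulVec, eval_pderiv_pictureForm_eq_zero hc2 hcS,
      mul_zero]
  · have hdet : IsUnit D.N.det := D.N.isUnit_iff_isUnit_det.mp
      (IsUnit.of_mul_eq_one _ D.mul_eq_one')
    rw [← hc, form, hessian_linSubst, D.N_mulVec_B_mulVec,
      Matrix.rank_mul_eq_left_of_isUnit_det _ _ hdet,
      Matrix.rank_mul_eq_right_of_isUnit_det _ _ (by rwa [Matrix.det_transpose])]
    exact rank_hessian_pictureForm hR (by exact_mod_cast hab) hbh hc2 hcS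
      (by rw [Pi.smul_apply]; exact smul_ne_zero c.ne_zero hv0)

theorem mk_mem_ellipticAbsolute (D : ProjectionData P x₀ y₀ g) {v : Fin 3 → ℂ}
    (hv : v ≠ 0) (hE : ((x₀ : ℂ) ^ 2 + (y₀ : ℂ) ^ 2) * (v 0 ^ 2 + v 1 ^ 2) + v 2 ^ 2 = 0) :
    Projectivization.mk ℂ (D.B *ᵥ v) (D.B_mulVec_ne_zero hv) ∈ ellipticAbsolute P := by
  have hw : directionMatrix (x₀ : ℂ) y₀ *ᵥ v ≠ 0 := by
    intro h
    apply D.B_mulVec_ne_zero hv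
    rw [← D.map_direction, h, map_zero]
  have hPw : projLin P (directionMatrix (x₀ : ℂ) y₀ *ᵥ v) ≠ 0 := by
    rw [D.map_direction]; exact D.B_mulVec_ne_zero hv
  have hmem : Projectivization.mk ℂ _ hw ∈ euclideanAbsolute := by
    obtain ⟨c, hc⟩ := Projectivization.exists_smul_eq_mk_rep ℂ _ hw
    change _ = 0 ∧ _ = 0
    rw [← hc, directionMatrix_mulVec]
    simp only [Units.smul_def, Pi.smul_apply, Matrix.cons_val, smul_eq_mul, mul_zero, true_and]
    linear_combination (c : ℂ) ^ 2 * hE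
  have h := mk_mem_projImage (P := P) hw hmem hPw
  rw [ellipticAbsolute]
  convert h using 1
  rw [Projectivization.mk_eq_mk_iff']
  exact ⟨1, by rw [one_smul, D.map_direction]⟩

end ProjectionData

/-! ### Generic centres -/

/-- The real form of the torus. -/
noncomputable def realTorusForm (a b : ℝ) : MvPolynomial (Fin 4) ℝ :=
  (X 0 ^ 2 + X 1 ^ 2 + X 2 ^ 2 + C a * X 3 ^ 2) ^ 2 - C b * (X 0 ^ 2 + X 1 ^ 2) * X 3 ^ 2

/-- A form that does not vanish at generic centres. -/
noncomputable def genericityForm (a b : ℝ) : MvPolynomial (Fin 4) ℝ :=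
  -- The factors exclude centres at infinity, in the symmetry plane `z = 0`, on the axis, on the
  -- planes `z² = (b/4 - a) w²` touching the torus along conics, and on the torus itself.
  X 3 * X 2 * (X 0 ^ 2 + X 1 ^ 2) * (C 4 * (X 2 ^ 2 + C a * X 3 ^ 2) - C b * X 3 ^ 2)
    * realTorusForm a b

theorem isHomogeneous_genericityForm (a b : ℝ) : (genericityForm a b).IsHomogeneous 10 := by
  have hX : ∀ i : Fin 4, (X i ^ 2 : MvPolynomial (Fin 4) ℝ).IsHomogeneous 2 :=
    fun i => isHomogeneous_X_pow i 2
  have hT : (realTorusForm a b).IsHomogeneous 4 :=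
    (((((hX 0).add (hX 1)).add (hX 2)).add ((hX 3).C_mul _)).pow 2).sub
      ((((hX 0).add (hX 1)).C_mul _).mul (hX 3))
  exact (((((isHomogeneous_X ℝ 3).mul (isHomogeneous_X ℝ 2)).mul ((hX 0).add (hX 1))).mul
    ((((hX 2).add ((hX 3).C_mul a)).C_mul 4).sub ((hX 3).C_mul b))).mul hT)

theorem eval_genericityForm (a b : ℝ) (o : Fin 4 → ℝ) : eval o (genericityForm a b)
    = o 3 * o 2 * (o 0 ^ 2 + o 1 ^ 2) * (4 * (o 2 ^ 2 + a * o 3 ^ 2) - b * o 3 ^ 2)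
      * ((o 0 ^ 2 + o 1 ^ 2 + o 2 ^ 2 + a * o 3 ^ 2) ^ 2
        - b * (o 0 ^ 2 + o 1 ^ 2) * o 3 ^ 2) := by
  simp [genericityForm, realTorusForm]

theorem genericityForm_ne_zero {a b : ℝ} (ha : 0 < a) (hb : 0 < b) : genericityForm a b ≠ 0 := by
  intro h
  -- The height `1 + b` is large enough to make the last two factors positive.
  have h1 := eval_genericityForm a b ![1, 0, 1 + b, 1]
  rw [h, map_zero] at h1
  simp only [Matrix.cons_val] at h1
  have e1 : 0 < 4 * ((1 + b) ^ 2 + a * 1 ^ 2) - b * 1 ^ 2 := by nlinarith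
  have e2 : 0 < (1 ^ 2 + 0 ^ 2 + (1 + b) ^ 2 + a * 1 ^ 2) ^ 2 - b * (1 ^ 2 + 0 ^ 2) * 1 ^ 2 := by
    nlinarith [mul_pos ha hb, sq_nonneg (1 ^ 2 + 0 ^ 2 + (1 + b) ^ 2 + a * 1 ^ 2 - 1)]
  have : 0 < 1 * (1 + b) * (1 ^ 2 + 0 ^ 2) * (4 * ((1 + b) ^ 2 + a * 1 ^ 2) - b * 1 ^ 2)
      * ((1 ^ 2 + 0 ^ 2 + (1 + b) ^ 2 + a * 1 ^ 2) ^ 2 - b * (1 ^ 2 + 0 ^ 2) * 1 ^ 2) := by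
    positivity
  exact this.ne h1

/-- For a real centre off the planes of symmetry, isotropic lines in the meridian plane through
the centre are in general position. -/
theorem four_mul_sub_sq_add_ne_zero {R g c : ℝ} (hR : 0 < R) (hg : g ≠ 0) (z : ℂ)
    (hz : z ^ 2 = -(R : ℂ)) : 4 * ((g : ℂ) - z) ^ 2 + c ≠ 0 := by
  intro h
  -- A real number would equal `8 g z`, whose square `-64 g² R` is negative.
  have h1 : ((4 * g ^ 2 - 4 * R + c : ℝ) : ℂ) = 8 * g * z := by
    push_cast
    linear_combination h - 4 * hz
  have h2 : (((4 * g ^ 2 - 4 * R + c) ^ 2 + 64 * g ^ 2 * R : ℝ) : ℂ) = 0 := by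
    push_cast at h1 ⊢
    linear_combination (4 * (g : ℂ) ^ 2 - 4 * R + c + 8 * g * z) * h1 + 64 * (g : ℂ) ^ 2 * hz
  have h3 : (4 * g ^ 2 - 4 * R + c) ^ 2 + 64 * g ^ 2 * R = 0 := by exact_mod_cast h2
  have : 0 < g ^ 2 := by positivity
  nlinarith [sq_nonneg (4 * g ^ 2 - 4 * R + c), mul_pos this hR]

/-- The picture from a centre in general position. -/
theorem exists_isDefiningForm {a b x₀ y₀ g : ℝ} (ha : 0 < a) (hb : 0 < b) (hab : b ≠ 4 * a)
    (hg : g ≠ 0) (hR : x₀ ^ 2 + y₀ ^ 2 ≠ 0) (hbh : b ≠ 4 * (g ^ 2 + a))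
    (hF : (x₀ ^ 2 + y₀ ^ 2 + g ^ 2 + a) ^ 2 ≠ b * (x₀ ^ 2 + y₀ ^ 2))
    {P : Matrix (Fin 3) (Fin 4) ℝ} (hP : P.rank = 3) (ho : P *ᵥ ![x₀, y₀, g, 1] = 0) :
    ∃ G : MvPolynomial (Fin 3) ℂ, IsDefiningForm 8 (picture P (torusForm a b)) G ∧
      ∃ p q : ProjSpace 2, p ≠ q ∧ p ∈ ellipticAbsolute P ∧ q ∈ ellipticAbsolute P ∧
        IsNode G p ∧ IsNode G q := by
  obtain ⟨D⟩ := nonempty_projectionData hR hP ho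
  have hbC : (b : ℂ) ≠ 0 := by exact_mod_cast hb.ne'
  have habC : (b : ℂ) ≠ 4 * a := by exact_mod_cast hab
  have hRC : (x₀ : ℂ) ^ 2 + (y₀ : ℂ) ^ 2 ≠ 0 := by exact_mod_cast hR
  have hbhC : (b : ℂ) ≠ 4 * (g ^ 2 + a) := by exact_mod_cast hbh
  have hFC : ((x₀ : ℂ) ^ 2 + (y₀ : ℂ) ^ 2 + g ^ 2 + a) ^ 2 ≠ b * ((x₀ : ℂ) ^ 2 + (y₀ : ℂ) ^ 2) := by
    exact_mod_cast hF
  have hhC : (g : ℂ) ^ 2 + a ≠ 0 := by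
    have : g ^ 2 + a ≠ 0 := by positivity
    exact_mod_cast this
  have hRpos : 0 < x₀ ^ 2 + y₀ ^ 2 := lt_of_le_of_ne (by positivity) hR.symm
  have hiso : ∀ (c : ℝ) (z : ℂ), z ^ 2 = -((x₀ : ℂ) ^ 2 + (y₀ : ℂ) ^ 2) →
      4 * ((g : ℂ) - z) ^ 2 + c ≠ 0 := fun c z hz =>
    four_mul_sub_sq_add_ne_zero hRpos hg z (by push_cast; exact hz)
  have h4a : ∀ z : ℂ, z ^ 2 = -((x₀ : ℂ) ^ 2 + (y₀ : ℂ) ^ 2) →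
      4 * ((g : ℂ) - z) ^ 2 + 4 * a ≠ 0 := fun z hz => by
    have := hiso (4 * a) z hz
    push_cast at this
    exact this
  refine ⟨D.form a b, ⟨D.isHomogeneous_form,
    squarefree_linSubst D.mul_eq_one' (squarefree_pictureForm hbC hRC hhC habC hbhC hFC),
    D.picture_eq hb.ne' hab hRC hFC fun K hK =>
      pictureForm_dvd hbC hRC hhC habC hbhC hFC (hiso b) h4a hK⟩, ?_⟩
  -- The nodes are the images of the two circular points of the horizontal planes.
  have hp : (![1, Complex.I, 0] : Fin 3 → ℂ) ≠ 0 := fun h => one_ne_zero (congrFun h 0)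
  have hq : (![1, -Complex.I, 0] : Fin 3 → ℂ) ≠ 0 := fun h => one_ne_zero (congrFun h 0)
  refine ⟨_, _, ?_, D.mk_mem_ellipticAbsolute hp (by simp),
    D.mk_mem_ellipticAbsolute hq (by simp),
    D.isNode_form hab hRC hbhC hp (by simp) (by simp),
    D.isNode_form hab hRC hbhC hq (by simp) (by simp)⟩
  rw [Ne, Projectivization.mk_eq_mk_iff']
  rintro ⟨c, hc⟩
  rw [← Matrix.mulVec_smul] at hc
  have h := congrArg (D.N *ᵥ ·) hc
  simp only [D.N_mulVec_B_mulVec] at h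
  have h0 := congrFun h 0
  have h1 := congrFun h 1
  simp at h0 h1
  rw [h0] at h1
  have : (2 : ℂ) * Complex.I = 0 := by linear_combination -h1
  simp at this

end TorusPicture

theorem mainTheorem2 (a b : ℝ) (ha : 0 < a) (hb : 0 < b) (hab : b ≠ 4 * a) :
    ∃ (e : ℕ) (H : MvPolynomial (Fin 4) ℝ), H.IsHomogeneous e ∧ H ≠ 0 ∧
      ∀ (o : Fin 4 → ℝ) (P : Matrix (Fin 3) (Fin 4) ℝ),
        o ≠ 0 → MvPolynomial.eval o H ≠ 0 → P.rank = 3 → P *ᵥ o = 0 →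
          ∃ G : MvPolynomial (Fin 3) ℂ,
            TorusPicture.IsDefiningForm 8
              (TorusPicture.picture P (TorusPicture.torusForm a b)) G ∧
            ∃ p q : TorusPicture.ProjSpace 2, p ≠ q ∧
              p ∈ TorusPicture.ellipticAbsolute P ∧ q ∈ TorusPicture.ellipticAbsolute P ∧
              TorusPicture.IsNode G p ∧ TorusPicture.IsNode G q := by
  refine ⟨10, TorusPicture.genericityForm a b, TorusPicture.isHomogeneous_genericityForm a b,
    TorusPicture.genericityForm_ne_zero ha hb, fun o P _ hH hP hPo => ?_⟩
  rw [TorusPicture.eval_genericityForm] at hH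
  obtain ⟨⟨⟨⟨h3, h2⟩, hR⟩, hbh⟩, hF⟩ : (((o 3 ≠ 0 ∧ o 2 ≠ 0) ∧ o 0 ^ 2 + o 1 ^ 2 ≠ 0) ∧
      4 * (o 2 ^ 2 + a * o 3 ^ 2) - b * o 3 ^ 2 ≠ 0) ∧
      (o 0 ^ 2 + o 1 ^ 2 + o 2 ^ 2 + a * o 3 ^ 2) ^ 2 - b * (o 0 ^ 2 + o 1 ^ 2) * o 3 ^ 2 ≠ 0 := by
    simpa only [mul_ne_zero_iff] using hH
  obtain ⟨x, hx⟩ : ∃ x, o 0 = o 3 * x := ⟨o 0 / o 3, by field_simp⟩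
  obtain ⟨y, hy⟩ : ∃ y, o 1 = o 3 * y := ⟨o 1 / o 3, by field_simp⟩
  obtain ⟨z, hz⟩ : ∃ z, o 2 = o 3 * z := ⟨o 2 / o 3, by field_simp⟩
  have ho : o = o 3 • ![x, y, z, 1] := by
    ext i
    fin_cases i <;> simp [hx, hy, hz]
  rw [ho, Matrix.mulVec_smul] at hPo
  rw [hx, hy] at hR hF
  rw [hz] at h2 hbh hF
  refine TorusPicture.exists_isDefiningForm ha hb hab (right_ne_zero_of_mul h2) (fun h => hR ?_)
    (fun h => hbh ?_) (fun h => hF ?_) hP ((smul_eq_zero.mp hPo).resolve_left h3)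
  · linear_combination o 3 ^ 2 * h
  · linear_combination -(o 3) ^ 2 * h
  · linear_combination o 3 ^ 4 * h
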